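/- **Random MERA state.** Let $L\ge 1$, $D_L\ge 2$ be integers and $\epsilon>0$ real. Define, downward in $k$, $$D'_k=\lceil \exp\{\log D_k-\epsilon 2^{L-k}\}\rceil\ (k\le L),\qquad D_k=\lceil \exp\{2\log D'_{k+1}-\epsilon 2^{L-k}\}\rceil\ (k<L),$$ and assume that $\epsilon, L$ are such that $D_0=1$. Let $\psi_0$ be the unit vector of one site of dimension $D_0=1$. For $1\le k\le L$ let $V_k$ be a product of isometries, one for each $0\le j<2^{k-1}$, mapping site $j$ (dimension $D_{k-1}$) to the pair of sites $2j,2j+1$ (dimension $D'_k$ each), and let $W_k$ be a product of isometries, one for each $0\le j<2^{k-1}$, mapping the pair of sites $2j+1,\,2j+2 \bmod 2^k$ (dimension $D'_k$ each) to the same pair (dimension $D_k$ each). All these isometries are independent and Haar-uniformly distributed. Put $N=2^L$, $$\psi=W_LV_L\cdots W_1V_1\psi_0,\quad \sigma=|\psi\rangle\langle\psi|,\qquad \phi=V_LW_{L-1}V_{L-1}\cdots W_1V_1\psi_0,\quad \tau=|\phi\rangle\langle\phi|,$$ which are states on a ring of $N$ sites. Write $S$ for the von Neumann entropy (natural logarithm)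 and $\rho_{[i,j]}$ for the reduced density matrix of $\rho$ on the interval of sites $i,i+1,\dots,j$ (modulo $N$). **Lemma.** There are constants $c_1,c_2,c_3>0$ that depend on nothing (in particular not on $D_L,\epsilon,L$) such that for all $D_L,L,\epsilon$ as above and every interval $[i,j]$ of length $l$ with $1\le l<N$, writing $m=\min(l,N-l)$ (so that $m=l$ if $l\le N/2$), the random variable $S(\sigma_{[i,j]})$ is integrable and $$E[S(\sigma_{[i,j]})]\ \ge\ c_1\log\bigl(D_{L-\lfloor\log_2 m\rfloor}\bigr)-c_2\log m-c_3 .$$ If moreover $\epsilon\le 1$, then $S(\tau_{[i,j]})$ is integrable as well, and $E[S(\tau_{[i,j]})]$ satisfies the same lower bound with the same constants. -/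

import Mathlib

open MeasureTheory

namespace RandomMERA

noncomputable section

/-! ### Haar-random isometries -/

/-- The unitary group `U(n)` of a finite index set carries its Borel σ-algebra. -/
instance instMeasurableSpaceUnitary (n : Type*) [Fintype n] [DecidableEq n] :
    MeasurableSpace (Matrix.unitaryGroup n ℂ) := borel _

instance instBorelSpaceUnitary (n : Type*) [Fintype n] [DecidableEq n] :
    BorelSpace (Matrix.unitaryGroup n ℂ) := ⟨rfl⟩

instance instTopologicalGroupUnitary (n : Type*) [Fintype n] [DecidableEq n] :
    IsTopologicalGroup (Matrix.unitaryGroup n ℂ) :=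
  inferInstanceAs (IsTopologicalGroup (unitary (Matrix n n ℂ)))

instance instCompactSpaceUnitary (n : Type*) [Fintype n] [DecidableEq n] :
    CompactSpace (Matrix.unitaryGroup n ℂ) := by
  have hK : IsCompact (Set.univ.pi fun _ : n => Set.univ.pi fun _ : n =>
      Metric.closedBall (0 : ℂ) 1) :=
    isCompact_univ_pi fun _ => isCompact_univ_pi fun _ => isCompact_closedBall 0 1
  have hU : IsCompact (Matrix.unitaryGroup n ℂ : Set (Matrix n n ℂ)) := by
    refine IsCompact.of_isClosed_subset (X := Matrix n n ℂ) hK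
      (isClosed_unitary (R := Matrix n n ℂ)) ?_
    intro U hU i _ j _
    simpa using entry_norm_bound_of_unitary hU i j
  exact isCompact_iff_compactSpace.1 hU

/-- The Haar probability measure on `U(n)`. -/
def haarUnitary (n : Type*) [Fintype n] [DecidableEq n] : Measure (Matrix.unitaryGroup n ℂ) :=
  Measure.haarMeasure (⊤ : TopologicalSpace.PositiveCompacts (Matrix.unitaryGroup n ℂ))

/-- The isometry `ℂ^α → ℂ^β` consisting of those columns of the unitary `U` that are selected by
`e : α ↪ β`. If `U` is Haar distributed, this is a Haar-uniform random isometry. -/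
def isometryOfUnitary {α β : Type*} [Fintype β] [DecidableEq β] (e : α ↪ β)
    (U : Matrix.unitaryGroup β ℂ) : Matrix β α ℂ :=
  (U : Matrix β β ℂ).submatrix id e

/-! ### States on a ring of sites, reduced density matrices, entropy

A vector of `n` sites with a `d`-dimensional space on each site is given by its coefficients
`(Fin n → Fin d) → ℂ` in the product basis. -/

/-- `|φ⟩⟨φ|`. -/
def projector {ι : Type*} (φ : ι → ℂ) : Matrix ι ι ℂ := Matrix.vecMulVec φ (star φ)

/-- The partial trace of `ρ` over all sites outside `A`. -/
def reduced {n d : ℕ} (ρ : Matrix (Fin n → Fin d) (Fin n → Fin d) ℂ) (A : Finset (Fin n)) :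
    Matrix ({s // s ∈ A} → Fin d) ({s // s ∈ A} → Fin d) ℂ :=
  Matrix.of fun a b => ∑ c : {s // s ∉ A} → Fin d,
    ρ ((Equiv.piEquivPiSubtypeProd (fun s => s ∈ A) fun _ => Fin d).symm (a, c))
      ((Equiv.piEquivPiSubtypeProd (fun s => s ∈ A) fun _ => Fin d).symm (b, c))

open scoped Classical in
/-- The von Neumann entropy `- tr (ρ log ρ)` (natural logarithm) of a Hermitian matrix;
by convention `0` for matrices that are not Hermitian. -/
def vonNeumannEntropy {ι : Type*} [Fintype ι] [DecidableEq ι] (ρ : Matrix ι ι ℂ) : ℝ :=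
  if h : ρ.IsHermitian then ∑ a, Real.negMulLog (h.eigenvalues a) else 0

/-- The interval of `l` consecutive sites `i, i + 1, …, i + l - 1` modulo `n`. -/
def interval {n : ℕ} (i : Fin n) (l : ℕ) : Finset (Fin n) :=
  (Finset.range l).image fun t => ⟨(i.val + t) % n, Nat.mod_lt _ (Nat.zero_lt_of_lt i.isLt)⟩

/-! ### One level of the network -/

/-- Site `2 j` on a ring of `2 ^ (k + 1)` sites. -/
def evenSite (k : ℕ) (j : Fin (2 ^ k)) : Fin (2 ^ (k + 1)) :=
  ⟨2 * j.val, by have := j.isLt; rw [pow_succ]; omega⟩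

/-- Site `2 j + 1` on a ring of `2 ^ (k + 1)` sites. -/
def oddSite (k : ℕ) (j : Fin (2 ^ k)) : Fin (2 ^ (k + 1)) :=
  ⟨2 * j.val + 1, by have := j.isLt; rw [pow_succ]; omega⟩

/-- Site `2 j + 2 mod 2 ^ (k + 1)` on a ring of `2 ^ (k + 1)` sites. -/
def nextEvenSite (k : ℕ) (j : Fin (2 ^ k)) : Fin (2 ^ (k + 1)) :=
  ⟨(2 * j.val + 2) % 2 ^ (k + 1), Nat.mod_lt _ (by positivity)⟩

/-- The product of isometries `V j`, mapping site `j` to the pair of sites `2 j, 2 j + 1`. -/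
def applyV (k : ℕ) {d d' : ℕ} (V : Fin (2 ^ k) → Matrix (Fin d' × Fin d') (Fin d) ℂ)
    (φ : (Fin (2 ^ k) → Fin d) → ℂ) : (Fin (2 ^ (k + 1)) → Fin d') → ℂ :=
  fun y => ∑ x, (∏ j, V j (y (evenSite k j), y (oddSite k j)) (x j)) * φ x

/-- The product of isometries `W j`, mapping the pair of sites `2 j + 1, 2 j + 2 mod 2 ^ (k + 1)`
to the same pair. -/
def applyW (k : ℕ) {d' d : ℕ} (W : Fin (2 ^ k) → Matrix (Fin d × Fin d) (Fin d' × Fin d') ℂ)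
    (φ : (Fin (2 ^ (k + 1)) → Fin d') → ℂ) : (Fin (2 ^ (k + 1)) → Fin d) → ℂ :=
  fun y => ∑ x, (∏ j, W j (y (oddSite k j), y (nextEvenSite k j))
    (x (oddSite k j), x (nextEvenSite k j))) * φ x

/-! ### The random MERA state -/

/-- Dimensions for which a MERA with `L` levels exists: `D k` is the dimension of a site after `W_k`
and `D' k` that of a site after `V_k`; there is one site of dimension `1` at the top, and the
dimensions admit isometries `V_k : ℂ^(D (k-1)) → ℂ^(D' k) ⊗ ℂ^(D' k)` and
`W_k : ℂ^(D' k) ⊗ ℂ^(D' k) → ℂ^(D k) ⊗ ℂ^(D k)`. -/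
structure Dims (L : ℕ) where
  D : ℕ → ℕ
  D' : ℕ → ℕ
  top : D 0 = 1
  hV : ∀ k < L, D k ≤ D' (k + 1) * D' (k + 1)
  hW : ∀ k < L, D' (k + 1) ≤ D (k + 1)

variable {L : ℕ}

/-- The sample space: for each of the `L` levels, a unitary for each of the isometries in `V`
and a unitary for each of the isometries in `W`. The index `k : Fin L` stands for level `k + 1`. -/
abbrev Sample (B : Dims L) : Type :=
  (k : Fin L) →
    (Fin (2 ^ k.val) → Matrix.unitaryGroup (Fin (B.D' (k.val + 1)) × Fin (B.D' (k.val + 1))) ℂ) ×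
    (Fin (2 ^ k.val) → Matrix.unitaryGroup (Fin (B.D (k.val + 1)) × Fin (B.D (k.val + 1))) ℂ)

/-- All unitaries are independent and Haar distributed. -/
def law (B : Dims L) : Measure (Sample B) :=
  Measure.pi fun _ => (Measure.pi fun _ => haarUnitary _).prod (Measure.pi fun _ => haarUnitary _)

/-- The random isometries whose product is `V_{k+1}`. -/
def isoV (B : Dims L) (ω : Sample B) (k : Fin L) (j : Fin (2 ^ k.val)) :
    Matrix (Fin (B.D' (k.val + 1)) × Fin (B.D' (k.val + 1))) (Fin (B.D k.val)) ℂ :=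
  isometryOfUnitary
    ((Fin.castLEEmb (B.hV k.val k.isLt)).trans finProdFinEquiv.symm.toEmbedding) ((ω k).1 j)

/-- The random isometries whose product is `W_{k+1}`. -/
def isoW (B : Dims L) (ω : Sample B) (k : Fin L) (j : Fin (2 ^ k.val)) :
    Matrix (Fin (B.D (k.val + 1)) × Fin (B.D (k.val + 1)))
      (Fin (B.D' (k.val + 1)) × Fin (B.D' (k.val + 1))) ℂ :=
  isometryOfUnitary
    ((Fin.castLEEmb (B.hW k.val k.isLt)).prodMap (Fin.castLEEmb (B.hW k.val k.isLt))) ((ω k).2 j)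

/-- `ψ(k) = W_k V_k ⋯ W_1 V_1 ψ_0`, where `ψ_0` is the unit vector of a one-dimensional space. -/
def psi (B : Dims L) (ω : Sample B) :
    (k : ℕ) → k ≤ L → (Fin (2 ^ k) → Fin (B.D k)) → ℂ
  | 0, _ => fun _ => 1
  | k + 1, hk => applyW k (isoW B ω ⟨k, hk⟩)
      (applyV k (isoV B ω ⟨k, hk⟩) (psi B ω k (Nat.le_of_succ_le hk)))

/-- `φ(k) = V_k W_{k-1} V_{k-1} ⋯ W_1 V_1 ψ_0` for `k ≥ 1` (the value at `k = 0` has no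
meaning). -/
def phi (B : Dims L) (ω : Sample B) :
    (k : ℕ) → k ≤ L → (Fin (2 ^ k) → Fin (B.D' k)) → ℂ
  | 0, _ => fun _ => 1
  | k + 1, hk => applyV k (isoV B ω ⟨k, hk⟩) (psi B ω k (Nat.le_of_succ_le hk))

/-- `S(σ(L)_A)`: entropy of the interval `i, …, i + l - 1` in the final state `ψ = ψ(L)`. -/
def sigmaEntropy (B : Dims L) (i : Fin (2 ^ L)) (l : ℕ) (ω : Sample B) : ℝ :=
  vonNeumannEntropy (reduced (projector (psi B ω L le_rfl)) (interval i l))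

/-- `S(τ(L)_A)`: entropy of the interval `i, …, i + l - 1` in the state `φ(L)`, i.e. before the
last row of isometries `W_L`. -/
def tauEntropy (B : Dims L) (i : Fin (2 ^ L)) (l : ℕ) (ω : Sample B) : ℝ :=
  vonNeumannEntropy (reduced (projector (phi B ω L le_rfl)) (interval i l))

/-! ### The choice of dimensions -/

/-- `⌈exp (log D - ε 2 ^ m)⌉`, which is `D'_{L-m}` if `D = D_{L-m}`. -/
def primeDim (ε : ℝ) (D m : ℕ) : ℕ := ⌈Real.exp (Real.log D - ε * 2 ^ m)⌉₊

/-- `D_{L-m}`, by recursion from the bottom `D_L` of the network. -/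
def bondDim (DL : ℕ) (ε : ℝ) : ℕ → ℕ
  | 0 => DL
  | m + 1 => ⌈Real.exp (2 * Real.log (primeDim ε (bondDim DL ε m) m) - ε * 2 ^ (m + 1))⌉₊

theorem primeDim_pos (ε : ℝ) (D m : ℕ) : 0 < primeDim ε D m :=
  Nat.ceil_pos.2 (Real.exp_pos _)

theorem bondDim_pos {DL : ℕ} {ε : ℝ} (hD : 1 < DL) (m : ℕ) : 0 < bondDim DL ε m := by
  cases m with
  | zero => exact lt_trans one_pos hD
  | succ m => exact Nat.ceil_pos.2 (Real.exp_pos _)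

theorem primeDim_le {ε : ℝ} (hε : 0 < ε) {D : ℕ} (hD : 0 < D) (m : ℕ) : primeDim ε D m ≤ D := by
  refine Nat.ceil_le.2 ?_
  have h : Real.exp (Real.log D) = D := Real.exp_log (by exact_mod_cast hD)
  calc Real.exp (Real.log D - ε * 2 ^ m) ≤ Real.exp (Real.log D) :=
        Real.exp_le_exp.2 (by have : 0 < ε * 2 ^ m := by positivity
                              linarith)
    _ = D := h

theorem bondDim_succ_le {DL : ℕ} {ε : ℝ} (hε : 0 < ε) (m : ℕ) :
    bondDim DL ε (m + 1) ≤
      primeDim ε (bondDim DL ε m) m * primeDim ε (bondDim DL ε m) m := by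
  refine Nat.ceil_le.2 ?_
  have hp := primeDim_pos ε (bondDim DL ε m) m
  set p := primeDim ε (bondDim DL ε m) m
  have hp' : (0 : ℝ) < p := by exact_mod_cast hp
  calc Real.exp (2 * Real.log p - ε * 2 ^ (m + 1)) ≤ Real.exp (Real.log p + Real.log p) :=
        Real.exp_le_exp.2 (by have : 0 < ε * 2 ^ (m + 1) := by positivity
                              linarith)
    _ = ((p * p : ℕ) : ℝ) := by rw [Real.exp_add, Real.exp_log hp']; push_cast; rfl

/-- The chosen dimensions: `D_L` is given and, for `k ≤ L`,
`D'_k = ⌈exp (log D_k - ε 2^(L-k))⌉` and `D_k = ⌈exp (2 log D'_{k+1} - ε 2^(L-k))⌉` (`k < L`), where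
`ε` and `L` are such that `D_0 = 1`. -/
def chosenDims (DL L : ℕ) (ε : ℝ) (hD : 1 < DL) (hε : 0 < ε) (h0 : bondDim DL ε L = 1) :
    Dims L where
  D k := bondDim DL ε (L - k)
  D' k := primeDim ε (bondDim DL ε (L - k)) (L - k)
  top := h0
  hV k hk := by
    have h : L - k = L - (k + 1) + 1 := by omega
    rw [h]
    exact bondDim_succ_le hε _
  hW k _ := primeDim_le hε (bondDim_pos hD _) _

end

end RandomMERA

open MeasureTheory

namespace RandomMERA

noncomputable section

/-! ### Second moments of the Haar measure -/

section Haar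

variable {n : Type*} [Fintype n] [DecidableEq n]

/-! The entropy is controlled through the purity `tr ρ_A²`. The tangent line of the logarithm at `c`
turns an upper bound `c` on the expected purity into the lower bound `-log c` on the expected
entropy (`integral_entropy_ge`).

The purity is quadratic in each gate and quadratic in its conjugate, so averaging over one row needs
only second Haar moments and yields a recursion (`sigmaPurity_succ`, `tauPurity_succ`). Colour the
sites by whether they lie in `A`. A gate whose two outputs have the same colour hands that colour on
to its input with weight one. A gate that is cut, with output dimension `D` per site, hands on
either colour, each with weight `D / (D² + 1)`. Since `2D / (D² + 1)` is at most one, the expected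
purity is at most the largest one among the colourings one row up. Since it is also at most `2 / D`,
a single cut gate already gives the bound `2 / D`.

It remains to find a cut gate at a high level, whichever colours were handed on. Gates well inside a
run of equal colour are not cut, so one full level maps a run of length `r` to one of length at
least `(r - 3) / 2`. Runs of both colours of length `m` therefore survive about `log₂ m - 2` levels,
and a colouring with both colours cuts a gate of `V` or of `W` (`exists_cut`). With `a = ⌊log₂ m⌋ ≥
2` this gives entropy at least `log D'_{L-a+2} - log 2`. One level up at most doubles the logarithm
of the dimension, so `log D_{L-a} ≤ 4 log D'_{L-a+2}`, whence the constant `1/4`. Small `m` is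
treated separately; only there, and only for `τ`, does `ε ≤ 1` enter. -/

instance instIsProbabilityMeasureHaarUnitary : IsProbabilityMeasure (haarUnitary n) :=
  ⟨by simpa [haarUnitary] using
    Measure.haarMeasure_self (K₀ := (⊤ : TopologicalSpace.PositiveCompacts
      (Matrix.unitaryGroup n ℂ)))⟩

instance instIsHaarMeasureHaarUnitary : (haarUnitary n).IsHaarMeasure := by
  unfold haarUnitary; infer_instance

theorem integrable_of_continuous {X E : Type*} [TopologicalSpace X] [CompactSpace X]
    [MeasurableSpace X] [OpensMeasurableSpace X] [NormedAddCommGroup E]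
    [SecondCountableTopologyEither X E]
    (μ : Measure X) [IsFiniteMeasure μ] {f : X → E} (hf : Continuous f) : Integrable f μ := by
  obtain ⟨C, hC⟩ := (isCompact_range hf).isBounded.exists_norm_le
  exact Integrable.of_bound hf.aestronglyMeasurable C
    (Filter.Eventually.of_forall fun x => hC _ ⟨x, rfl⟩)

instance instSecondCountableUnitary : SecondCountableTopology (Matrix.unitaryGroup n ℂ) :=
  haveI : SecondCountableTopology (Matrix n n ℂ) :=
    inferInstanceAs (SecondCountableTopology (n → n → ℂ))
  TopologicalSpace.Subtype.secondCountableTopology (Matrix.unitaryGroup n ℂ : Set (Matrix n n ℂ))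

@[fun_prop]
theorem continuous_unitary_entry (a α : n) :
    Continuous fun U : Matrix.unitaryGroup n ℂ => (U : Matrix n n ℂ) a α :=
  (continuous_subtype_val (p := fun M : Matrix n n ℂ => M ∈ Matrix.unitaryGroup n ℂ)).matrix_elem
    a α

/-- Second moment of the entries of a Haar-random unitary. -/
def haarMoment (α β γ δ a b a' b' : n) : ℂ :=
  ∫ U, (U : Matrix n n ℂ) a α * (U : Matrix n n ℂ) b β * star ((U : Matrix n n ℂ) a' γ) *
    star ((U : Matrix n n ℂ) b' δ) ∂haarUnitary n

theorem haarMoment_eq_integral_mul (g : Matrix.unitaryGroup n ℂ) (α β γ δ a b a' b' : n) :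
    haarMoment α β γ δ a b a' b' =
      ∫ U, ((g : Matrix n n ℂ) * (U : Matrix n n ℂ)) a α *
        ((g : Matrix n n ℂ) * (U : Matrix n n ℂ)) b β *
        star (((g : Matrix n n ℂ) * (U : Matrix n n ℂ)) a' γ) *
        star (((g : Matrix n n ℂ) * (U : Matrix n n ℂ)) b' δ) ∂haarUnitary n :=
  (integral_mul_left_eq_self (μ := haarUnitary n) (fun U : Matrix.unitaryGroup n ℂ =>
    (U : Matrix n n ℂ) a α * (U : Matrix n n ℂ) b β * star ((U : Matrix n n ℂ) a' γ) *
    star ((U : Matrix n n ℂ) b' δ)) g).symm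

/-- The diagonal unitary with phase `z` at index `c`. -/
def phaseUnitary (c : n) (z : ℂ) (hz : star z * z = 1) : Matrix.unitaryGroup n ℂ :=
  ⟨Matrix.diagonal fun i => if i = c then z else 1, by
    rw [Matrix.mem_unitaryGroup_iff', Matrix.star_eq_conjTranspose,
      Matrix.diagonal_conjTranspose, Matrix.diagonal_mul_diagonal, ← Matrix.diagonal_one]
    congr 1
    funext i
    by_cases h : i = c
    · simpa [h] using hz
    · simp [h]⟩

/-- Phases kill every moment whose unconjugated and conjugated row indices differ as multisets. Only
left invariance is used throughout, so the column indices are spectators. -/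
theorem haarMoment_phase (c : n) (z : ℂ) (hz : star z * z = 1) (α β γ δ a b a' b' : n) :
    haarMoment α β γ δ a b a' b' =
      (if a = c then z else 1) * (if b = c then z else 1) * (if a' = c then star z else 1) *
        (if b' = c then star z else 1) * haarMoment α β γ δ a b a' b' := by
  conv_lhs => rw [haarMoment_eq_integral_mul (phaseUnitary c z hz)]
  rw [haarMoment, ← integral_const_mul]
  congr 1
  funext U
  simp only [phaseUnitary, Matrix.diagonal_mul, star_mul', apply_ite star, star_one]
  ring

/-- The unitary permuting the basis. -/
def permUnitary (σ : Equiv.Perm n) : Matrix.unitaryGroup n ℂ :=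
  ⟨(1 : Matrix n n ℂ).submatrix σ id, by
    rw [Matrix.mem_unitaryGroup_iff', Matrix.star_eq_conjTranspose, Matrix.conjTranspose_submatrix,
      Matrix.conjTranspose_one, Matrix.submatrix_mul_equiv]
    simp⟩

theorem haarMoment_perm (σ : Equiv.Perm n) (α β γ δ a b a' b' : n) :
    haarMoment α β γ δ a b a' b' = haarMoment α β γ δ (σ a) (σ b) (σ a') (σ b') := by
  rw [haarMoment_eq_integral_mul (permUnitary σ), haarMoment]
  have h : ∀ (U : Matrix n n ℂ) a α,
      (((permUnitary σ : Matrix.unitaryGroup n ℂ) : Matrix n n ℂ) * U) a α = U (σ a) α := by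
    intro U a α
    simp [permUnitary, Matrix.mul_apply, Matrix.one_apply]
  simp only [h]

/-- The rank-one matrix on the vector `e_a + 2 e_b`. -/
def reflectionProjector (a b : n) : Matrix n n ℂ :=
  Matrix.vecMulVec (Pi.single a 1 + Pi.single b 2) (Pi.single a 1 + Pi.single b 2)

theorem reflectionProjector_mul_self {a b : n} (h : a ≠ b) :
    reflectionProjector a b * reflectionProjector a b = (5 : ℂ) • reflectionProjector a b := by
  rw [reflectionProjector, Matrix.vecMulVec_mul_vecMulVec]
  have : (Pi.single a 1 + Pi.single b 2 : n → ℂ) ⬝ᵥ (Pi.single a 1 + Pi.single b 2) = 5 := by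
    simp [h, h.symm]
    norm_num
  rw [this]
  ext i j
  simp only [Matrix.vecMulVec_apply, Matrix.smul_apply, Pi.smul_apply, smul_eq_mul]
  ring

omit [Fintype n] in
theorem reflectionProjector_star (a b : n) :
    star (reflectionProjector a b) = reflectionProjector a b := by
  rw [Matrix.star_eq_conjTranspose, reflectionProjector, Matrix.conjTranspose_vecMulVec]
  congr 1 <;> simp

/-- The reflection along `e_a + 2 e_b`. -/
def reflectionUnitary {a b : n} (h : a ≠ b) : Matrix.unitaryGroup n ℂ :=
  ⟨1 - (2 / 5 : ℂ) • reflectionProjector a b, by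
    rw [Matrix.mem_unitaryGroup_iff', star_sub, star_smul, reflectionProjector_star, star_one]
    have : star (2 / 5 : ℂ) = 2 / 5 := by simp
    rw [this, sub_mul, mul_sub, mul_sub, smul_mul_smul_comm, reflectionProjector_mul_self h]
    simp only [mul_one, one_mul, smul_smul]
    norm_num
    module⟩

theorem reflectionUnitary_mul_apply {a b : n} (h : a ≠ b) (U : Matrix n n ℂ) (α : n) :
    (((reflectionUnitary h : Matrix.unitaryGroup n ℂ) : Matrix n n ℂ) * U) a α =
      ∑ i : Fin 2, ![(3 / 5 : ℂ), -4 / 5] i * U (![a, b] i) α := by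
  simp only [reflectionUnitary, reflectionProjector, sub_mul, one_mul, smul_mul_assoc,
    Matrix.sub_apply, Matrix.smul_apply, Matrix.vecMulVec_mul, Matrix.vecMulVec_apply]
  simp [Matrix.add_vecMul, h]
  ring

/-- Phases and permutations cannot relate the moment with four equal rows to the others; a unitary
mixing two rows does. The choice `e_a + 2 e_b` makes the mixing coefficients rational. -/
theorem haarMoment_reflection {a b : n} (h : a ≠ b) (α β γ δ : n) :
    haarMoment α β γ δ a a a a =
      ∑ p : Fin 2 × Fin 2 × Fin 2 × Fin 2,
        ![(3 / 5 : ℂ), -4 / 5] p.1 * ![(3 / 5 : ℂ), -4 / 5] p.2.1 *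
          ![(3 / 5 : ℂ), -4 / 5] p.2.2.1 * ![(3 / 5 : ℂ), -4 / 5] p.2.2.2 *
          haarMoment α β γ δ (![a, b] p.1) (![a, b] p.2.1) (![a, b] p.2.2.1) (![a, b] p.2.2.2) := by
  have hs : ∀ k : Fin 2, star (![(3 / 5 : ℂ), -4 / 5] k) = ![(3 / 5 : ℂ), -4 / 5] k := by
    intro k; fin_cases k <;> simp
  rw [haarMoment_eq_integral_mul (reflectionUnitary h)]
  simp only [reflectionUnitary_mul_apply, haarMoment, ← integral_const_mul]
  rw [← integral_finsetSum _ (fun p _ => integrable_of_continuous (haarUnitary n)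
    (by fun_prop))]
  congr 1
  funext U
  simp only [Fintype.sum_prod_type, Fin.sum_univ_two, star_add, star_mul', hs]
  ring

theorem haarMoment_eq_zero {α β γ δ a b a' b' : n} (ha : a ≠ b) (h₁ : a ≠ a') (h₂ : a ≠ b') :
    haarMoment α β γ δ a b a' b' = 0 := by
  have := haarMoment_phase a (-1) (by simp) α β γ δ a b a' b'
  simp only [if_true, if_neg ha.symm, if_neg h₁.symm, if_neg h₂.symm] at this
  linear_combination this / 2

omit [Fintype n] in
theorem exists_perm_pair {a b c d : n} (hab : a ≠ b) (hcd : c ≠ d) :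
    ∃ σ : Equiv.Perm n, σ a = c ∧ σ b = d := by
  refine ⟨Equiv.swap (Equiv.swap a c b) d * Equiv.swap a c, ?_, ?_⟩
  · have : Equiv.swap a c b ≠ c := fun h => hab (by
      have := congrArg (Equiv.swap a c) h
      simpa using this.symm)
    simp [Equiv.swap_apply_of_ne_of_ne this.symm hcd]
  · simp

theorem haarMoment_diag_eq {a b : n} (h : a ≠ b) (α β γ δ : n) :
    haarMoment α β γ δ a a a a = haarMoment α β γ δ a b a b + haarMoment α β γ δ a b b a := by
  have hr := haarMoment_reflection h α β γ δ
  have e1 : haarMoment α β γ δ b b b b = haarMoment α β γ δ a a a a := by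
    rw [haarMoment_perm (Equiv.swap a b) α β γ δ b b b b]; simp
  have e2 : haarMoment α β γ δ b a b a = haarMoment α β γ δ a b a b := by
    rw [haarMoment_perm (Equiv.swap a b) α β γ δ b a b a]; simp
  have e3 : haarMoment α β γ δ b a a b = haarMoment α β γ δ a b b a := by
    rw [haarMoment_perm (Equiv.swap a b) α β γ δ b a a b]; simp
  -- The phase `-1` at `b` kills the patterns with an odd number of `b`; the phase `i` below kills
  -- `aabb` and `bbaa`.
  have neg : ∀ w x y z, haarMoment α β γ δ w x y z =
      (if w = b then -1 else 1) * (if x = b then -1 else 1) * (if y = b then -1 else 1) *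
        (if z = b then -1 else 1) * haarMoment α β γ δ w x y z := by
    intro w x y z
    simpa using haarMoment_phase b (-1) (by simp) α β γ δ w x y z
  have im : ∀ w x y z, haarMoment α β γ δ w x y z =
      (if w = b then Complex.I else 1) * (if x = b then Complex.I else 1) *
      (if y = b then -Complex.I else 1) *
        (if z = b then -Complex.I else 1) * haarMoment α β γ δ w x y z := by
    intro w x y z
    simpa using haarMoment_phase b Complex.I (by simp) α β γ δ w x y z
  have z1 := neg b a a a
  have z2 := neg a b a a
  have z3 := neg a a b a
  have z4 := neg a a a b
  have z5 := neg b b b a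
  have z6 := neg b b a b
  have z7 := neg b a b b
  have z8 := neg a b b b
  have z9 := im a a b b
  have z10 := im b b a a
  simp only [if_true, if_neg h, mul_one, one_mul, mul_neg, neg_mul, Complex.I_mul_I, neg_neg] at z1 z2 z3 z4 z5 z6 z7 z8 z9 z10
  simp only [Fintype.sum_prod_type, Fin.sum_univ_two, Matrix.cons_val_zero, Matrix.cons_val_one,
    e1, e2, e3] at hr
  rw [CharZero.eq_neg_self_iff.1 z1, CharZero.eq_neg_self_iff.1 z2, CharZero.eq_neg_self_iff.1 z3,
    CharZero.eq_neg_self_iff.1 z4, CharZero.eq_neg_self_iff.1 z5, CharZero.eq_neg_self_iff.1 z6,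
    CharZero.eq_neg_self_iff.1 z7, CharZero.eq_neg_self_iff.1 z8, CharZero.eq_neg_self_iff.1 z9,
    CharZero.eq_neg_self_iff.1 z10] at hr
  -- `288/625` is both `1 - (3/5)⁴ - (4/5)⁴` and `2 (3/5)² (4/5)²`.
  linear_combination (625 / 288 : ℂ) * hr

theorem exists_haarMoment_eq (α β γ δ : n) :
    ∃ p q : ℂ, (∀ a, haarMoment α β γ δ a a a a = p + q) ∧
      (∀ a b, a ≠ b → haarMoment α β γ δ a b a b = p) ∧
      ∀ a b, a ≠ b → haarMoment α β γ δ a b b a = q := by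
  by_cases h : ∃ a b : n, a ≠ b
  · obtain ⟨a, b, hab⟩ := h
    refine ⟨haarMoment α β γ δ a b a b, haarMoment α β γ δ a b b a, fun c => ?_,
      fun c d hcd => ?_, fun c d hcd => ?_⟩
    · rw [← haarMoment_diag_eq hab, haarMoment_perm (Equiv.swap c a)]
      simp
    · obtain ⟨σ, rfl, rfl⟩ := exists_perm_pair hcd hab
      exact haarMoment_perm σ α β γ δ c d c d
    · obtain ⟨σ, rfl, rfl⟩ := exists_perm_pair hcd hab
      exact haarMoment_perm σ α β γ δ c d d c
  · push Not at h
    -- With a single row index the other two clauses are vacuous, and any splitting of the one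
    -- moment serves.
    refine ⟨haarMoment α β γ δ α α α α, 0, fun a => ?_, fun a b hab => (hab (h a b)).elim,
      fun a b hab => (hab (h a b)).elim⟩
    rw [h a α, add_zero]

theorem unitary_sum_mul_star (U : Matrix.unitaryGroup n ℂ) (α γ : n) :
    ∑ a, (U : Matrix n n ℂ) a α * star ((U : Matrix n n ℂ) a γ) = if α = γ then 1 else 0 := by
  have h := congrFun (congrFun (Matrix.UnitaryGroup.star_mul_self U) γ) α
  rw [Matrix.star_eq_conjTranspose, Matrix.mul_apply, Matrix.one_apply] at h
  simp only [Matrix.conjTranspose_apply] at h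
  simp only [mul_comm _ (star _), h, eq_comm]

/-- The columns are orthonormal for every `U`, so the integrand is constant. This and the swapped
sum are the two equations for `p` and `q`. -/
theorem sum_haarMoment (α β γ δ : n) :
    ∑ x : n × n, haarMoment α β γ δ x.1 x.2 x.1 x.2 =
      (if α = γ then 1 else 0) * (if β = δ then 1 else 0) := by
  simp only [haarMoment]
  rw [← integral_finsetSum _ (fun p _ => integrable_of_continuous (haarUnitary n)
    (by fun_prop))]
  have h : ∀ U : Matrix.unitaryGroup n ℂ, ∑ x : n × n, (U : Matrix n n ℂ) x.1 α *
      (U : Matrix n n ℂ) x.2 β * star ((U : Matrix n n ℂ) x.1 γ) *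
      star ((U : Matrix n n ℂ) x.2 δ) =
      (if α = γ then 1 else 0) * (if β = δ then 1 else 0) := by
    intro U
    rw [← unitary_sum_mul_star U, ← unitary_sum_mul_star U, Fintype.sum_mul_sum,
      Fintype.sum_prod_type]
    exact Finset.sum_congr rfl fun _ _ => Finset.sum_congr rfl fun _ _ => by ring
  simp only [h]
  simp

theorem sum_haarMoment_swap (α β γ δ : n) :
    ∑ x : n × n, haarMoment α β γ δ x.1 x.2 x.2 x.1 =
      (if α = δ then 1 else 0) * (if β = γ then 1 else 0) := by
  rw [← sum_haarMoment α β δ γ]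
  refine Finset.sum_congr rfl fun x _ => ?_
  simp only [haarMoment]
  congr 1
  funext U
  ring

end Haar

/-- Let `D` be the cardinality of `κ` and `X`, `Y` the two products of Kronecker deltas. The
normalisations read `D⁴ p + D² q = X` and `D⁴ q + D² p = Y`, while the cut sum is `D³ (p + q)`. Only
`p + q` is needed, so `D = 1`, where the system is singular, is no exception. -/
theorem sum_haarMoment_cut {κ : Type*} [Fintype κ] [DecidableEq κ] [Nonempty κ]
    (α β γ δ : κ × κ) :
    ∑ z : (κ × κ) × (κ × κ), haarMoment α β γ δ z.1 z.2 (z.2.1, z.1.2) (z.1.1, z.2.2) =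
      (Fintype.card κ / (Fintype.card κ ^ 2 + 1) : ℂ) *
        ((if α = γ then 1 else 0) * (if β = δ then 1 else 0) +
          (if α = δ then 1 else 0) * (if β = γ then 1 else 0)) := by
  obtain ⟨p, q, hr, hp, hq⟩ := exists_haarMoment_eq α β γ δ
  have h1 := sum_haarMoment α β γ δ
  have h2 := sum_haarMoment_swap α β γ δ
  have e1 : ∀ x : (κ × κ) × (κ × κ), haarMoment α β γ δ x.1 x.2 x.1 x.2 =
      p + if x.1 = x.2 then q else 0 := by
    rintro ⟨x, y⟩
    by_cases h : x = y
    · subst h; simp [hr]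
    · simp [h, hp x y h]
  have e2 : ∀ x : (κ × κ) × (κ × κ), haarMoment α β γ δ x.1 x.2 x.2 x.1 =
      q + if x.1 = x.2 then p else 0 := by
    rintro ⟨x, y⟩
    by_cases h : x = y
    · subst h; simp [hr, add_comm]
    · simp [h, hq x y h]
  have e3 : ∀ z : (κ × κ) × (κ × κ),
      haarMoment α β γ δ z.1 z.2 (z.2.1, z.1.2) (z.1.1, z.2.2) =
      (if z.1.1 = z.2.1 then p else 0) + if z.1.2 = z.2.2 then q else 0 := by
    rintro ⟨⟨x, x'⟩, ⟨y, y'⟩⟩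
    by_cases h : x = y <;> by_cases h' : x' = y'
    · subst h h'; simp [hr]
    · subst h; simp [h', hp (x, x') (x, y') (by simp [h'])]
    · subst h'; simp [h, hq (x, x') (y, x') (by simp [h])]
    · simp only [h, h', if_false, add_zero]
      -- When both components differ, the row `(x, x')` occurs only once.
      exact haarMoment_eq_zero (by simp [h]) (by simp [h]) (by simp [h'])
  simp only [e1, Finset.sum_add_distrib, Finset.sum_const, Finset.card_univ, Fintype.card_prod,
    nsmul_eq_mul, Fintype.sum_prod_type, Finset.sum_ite_eq, Finset.mem_univ, if_true] at h1
  simp only [e2, Finset.sum_add_distrib, Finset.sum_const, Finset.card_univ, Fintype.card_prod,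
    nsmul_eq_mul, Fintype.sum_prod_type, Finset.sum_ite_eq, Finset.mem_univ, if_true] at h2
  have s1 : ∑ z : (κ × κ) × (κ × κ), (if z.1.1 = z.2.1 then p else 0) =
      (Fintype.card κ : ℂ) ^ 3 * p := by
    have : ∀ x : κ × κ, ∑ y : κ × κ, (if x.1 = y.1 then p else 0) =
        (Fintype.card κ : ℂ) * p := by
      intro x
      rw [Fintype.sum_prod_type_right]
      simp
    rw [Fintype.sum_prod_type]
    simp [this]
    ring
  have s2 : ∑ z : (κ × κ) × (κ × κ), (if z.1.2 = z.2.2 then q else 0) =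
      (Fintype.card κ : ℂ) ^ 3 * q := by
    have : ∀ x : κ × κ, ∑ y : κ × κ, (if x.2 = y.2 then q else 0) =
        (Fintype.card κ : ℂ) * q := by
      intro x
      rw [Fintype.sum_prod_type]
      simp
    rw [Fintype.sum_prod_type]
    simp [this]
    ring
  simp only [e3, Finset.sum_add_distrib, s1, s2, ← h1, ← h2]
  have hc : ((Fintype.card κ : ℂ) ^ 2 + 1) ≠ 0 := by
    exact_mod_cast (by positivity : Fintype.card κ ^ 2 + 1 ≠ 0)
  push_cast
  field_simp
  ring

/-! ### Purity and its average over one row of gates -/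

section Purity

variable {S J ι κ : Type*}

/-- The configuration that agrees with `x` on `A` and with `y` off `A`. -/
def mix (A : S → Bool) (x y : S → ι) : S → ι := fun s => if A s then x s else y s

/-- The purity `tr (ρ_A ^ 2)` of the reduced density matrix of `φ` on the set `A` of sites. -/
def purity [Fintype S] [DecidableEq S] [Fintype ι] (A : S → Bool) (φ : (S → ι) → ℂ) : ℂ :=
  ∑ x, ∑ y, φ x * φ y * star (φ (mix A y x)) * star (φ (mix A x y))

/-- Action of a row of gates, each of which outputs a pair of sites. -/
def gateRow [Fintype J] [DecidableEq J] [Fintype ι] (W : J → Matrix (κ × κ) ι ℂ)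
    (φ : (J → ι) → ℂ) : (J → κ × κ) → ℂ :=
  fun y => ∑ x, (∏ j, W j (y j) (x j)) * φ x

/-- `mix` for a pair of sites. -/
def mixPair (a : Bool × Bool) (x y : κ × κ) : κ × κ :=
  (if a.1 then x.1 else y.1, if a.2 then x.2 else y.2)

/-- The purity of a state whose sites are grouped into pairs. -/
def pairPurity [Fintype J] [DecidableEq J] [Fintype κ] (A : J → Bool × Bool)
    (φ : (J → κ × κ) → ℂ) : ℂ :=
  ∑ x, ∑ y, φ x * φ y * star (φ fun j => mixPair (A j) (y j) (x j)) *
    star (φ fun j => mixPair (A j) (x j) (y j))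

/-- The contribution of a single gate to the purity. -/
def gateTerm [Fintype κ] (a : Bool × Bool) (W : Matrix (κ × κ) ι ℂ) (α β γ δ : ι) : ℂ :=
  ∑ z : (κ × κ) × (κ × κ), W z.1 α * W z.2 β * star (W (mixPair a z.2 z.1) γ) *
    star (W (mixPair a z.1 z.2) δ)

theorem sum_mul_sum_mul_sum_mul_sum {X : Type*} [Fintype X] (f g h k : X → ℂ) :
    (∑ x, f x) * (∑ x, g x) * (∑ x, h x) * (∑ x, k x) =
      ∑ q : X × X × X × X, f q.1 * g q.2.1 * h q.2.2.1 * k q.2.2.2 := by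
  simp only [Fintype.sum_prod_type, ← Finset.mul_sum, ← Finset.sum_mul]

/-- Expanding the four copies of the row makes the purity a sum of products over gates, so
independent gates can be averaged one by one. -/
theorem pairPurity_gateRow [Fintype J] [DecidableEq J] [Fintype ι] [Fintype κ]
    (A : J → Bool × Bool) (W : J → Matrix (κ × κ) ι ℂ) (φ : (J → ι) → ℂ) :
    pairPurity A (gateRow W φ) =
      ∑ q : (J → ι) × (J → ι) × (J → ι) × (J → ι),
        φ q.1 * φ q.2.1 * star (φ q.2.2.1) * star (φ q.2.2.2) *
          ∏ j, gateTerm (A j) (W j) (q.1 j) (q.2.1 j) (q.2.2.1 j) (q.2.2.2 j) := by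
  classical
  simp only [gateTerm, Finset.prod_univ_sum, Fintype.piFinset_univ]
  have h : ∀ x y : J → κ × κ, gateRow W φ x * gateRow W φ y *
      star (gateRow W φ fun j => mixPair (A j) (y j) (x j)) *
      star (gateRow W φ fun j => mixPair (A j) (x j) (y j)) =
      ∑ q : (J → ι) × (J → ι) × (J → ι) × (J → ι),
        φ q.1 * φ q.2.1 * star (φ q.2.2.1) * star (φ q.2.2.2) *
          ∏ j, (W j (x j) (q.1 j) * W j (y j) (q.2.1 j) *
            star (W j (mixPair (A j) (y j) (x j)) (q.2.2.1 j)) *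
            star (W j (mixPair (A j) (x j) (y j)) (q.2.2.2 j))) := by
    intro x y
    simp only [gateRow, star_sum]
    rw [sum_mul_sum_mul_sum_mul_sum]
    refine Finset.sum_congr rfl fun _ _ => ?_
    simp only [Finset.prod_mul_distrib, star_mul', star_prod]
    ring
  simp only [pairPurity, h, Finset.mul_sum]
  rw [← Fintype.sum_prod_type' (f := fun x y : J → κ × κ => ∑ q : (J → ι) × (J → ι) × (J → ι) × (J → ι), _), Finset.sum_comm]
  refine Finset.sum_congr rfl fun q _ => ?_
  exact (Fintype.sum_equiv (Equiv.arrowProdEquivProdArrow J (fun _ => κ × κ) (fun _ => κ × κ)) _ _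
    fun _ => rfl).symm

/-- The two ways of contracting four copies of a site. -/
def pairing [DecidableEq ι] (s : Bool) (α β γ δ : ι) : ℂ :=
  if γ = (if s then β else α) ∧ δ = (if s then α else β) then 1 else 0

/-- On two replicas, `pairing false` is the identity and `pairing true` the swap; swapping exactly
the sites selected by `s` produces the purity of that set. -/
theorem sum_prod_pairing [Fintype J] [DecidableEq J] [Fintype ι] [DecidableEq ι]
    (s : J → Bool) (φ : (J → ι) → ℂ) :
    ∑ q : (J → ι) × (J → ι) × (J → ι) × (J → ι),
        φ q.1 * φ q.2.1 * star (φ q.2.2.1) * star (φ q.2.2.2) *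
          ∏ j, pairing (s j) (q.1 j) (q.2.1 j) (q.2.2.1 j) (q.2.2.2 j) = purity s φ := by
  have h : ∀ x y u v : J → ι, ∏ j, pairing (s j) (x j) (y j) (u j) (v j) =
      (if u = mix s y x then 1 else 0) * (if v = mix s x y then 1 else 0) := by
    intro x y u v
    simp only [pairing, Finset.prod_ite_zero, Finset.prod_const_one, Finset.mem_univ,
      true_implies, ite_and, funext_iff, mix]
    split_ifs <;> simp
  simp only [h, Fintype.sum_prod_type, purity]
  refine Finset.sum_congr rfl fun x _ => Finset.sum_congr rfl fun y _ => ?_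
  simp

/-- The values that a gate may hand on to its input: one if it is not cut, both if it is. -/
def gateOptions (a : Bool × Bool) : Finset Bool := {a.1, a.2}

/-- The average weight of a gate with output dimension `D` per site. -/
def gateWeight (D : ℕ) (a : Bool × Bool) : ℝ := if a.1 = a.2 then 1 else D / (D ^ 2 + 1)

theorem sum_isometry_mul_star [Fintype κ] [DecidableEq κ] [DecidableEq ι] (e : ι ↪ κ × κ)
    (U : Matrix.unitaryGroup (κ × κ) ℂ) (α γ : ι) :
    ∑ a, isometryOfUnitary e U a α * star (isometryOfUnitary e U a γ) =
      if α = γ then 1 else 0 := by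
  simpa [isometryOfUnitary, e.injective.eq_iff] using unitary_sum_mul_star U (e α) (e γ)

/-- An uncut gate contracts by the isometry property for every `U`; only a cut gate needs the
average. Passing to an isometry merely selects columns, and the moment formulas hold for all
columns. -/
theorem integral_gateTerm [Fintype κ] [DecidableEq κ] [Nonempty κ] [DecidableEq ι] (e : ι ↪ κ × κ)
    (a : Bool × Bool) (α β γ δ : ι) :
    ∫ U, gateTerm a (isometryOfUnitary e U) α β γ δ ∂haarUnitary (κ × κ) =
      (gateWeight (Fintype.card κ) a : ℂ) * ∑ s ∈ gateOptions a, pairing s α β γ δ := by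
  obtain ⟨a, a'⟩ := a
  have one : ∀ U : Matrix.unitaryGroup (κ × κ) ℂ, ∀ γ δ : ι,
      ∑ z : (κ × κ) × (κ × κ), isometryOfUnitary e U z.1 α * isometryOfUnitary e U z.2 β *
        star (isometryOfUnitary e U z.1 γ) * star (isometryOfUnitary e U z.2 δ) =
      (if γ = α then 1 else 0) * (if δ = β then 1 else 0) := by
    intro U γ δ
    simp only [@eq_comm _ γ, @eq_comm _ δ]
    rw [← sum_isometry_mul_star e U,
      ← sum_isometry_mul_star e U, Fintype.sum_mul_sum, Fintype.sum_prod_type]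
    exact Finset.sum_congr rfl fun _ _ => Finset.sum_congr rfl fun _ _ => by ring
  have cut : ∀ γ δ : ι, ∫ U, ∑ z : (κ × κ) × (κ × κ), isometryOfUnitary e U z.1 α *
      isometryOfUnitary e U z.2 β * star (isometryOfUnitary e U (z.2.1, z.1.2) γ) *
      star (isometryOfUnitary e U (z.1.1, z.2.2) δ) ∂haarUnitary (κ × κ) =
      (Fintype.card κ / (Fintype.card κ ^ 2 + 1) : ℂ) *
        (pairing true α β γ δ + pairing false α β γ δ) := by
    intro γ δ
    have h := sum_haarMoment_cut (e α) (e β) (e γ) (e δ)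
    simp only [haarMoment] at h
    rw [← integral_finsetSum _ (fun p _ => integrable_of_continuous (haarUnitary (κ × κ))
      (by fun_prop))] at h
    refine h.trans ?_
    simp only [e.injective.eq_iff, pairing, ite_and, if_true, Bool.false_eq_true, if_false,
      @eq_comm _ γ, @eq_comm _ δ]
    congr 1
    split_ifs <;> simp
  have ite2 : ∀ p q : Prop, [Decidable p] → [Decidable q] →
      (if p ∧ q then (1 : ℂ) else 0) = (if p then 1 else 0) * (if q then 1 else 0) := by
    intro p q _ _
    split_ifs <;> simp_all
  cases a <;> cases a'
  · have h : ∀ U, gateTerm (false, false) (isometryOfUnitary e U) α β γ δ =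
        pairing false α β γ δ := by
      intro U
      simp only [gateTerm, mixPair, pairing, Bool.false_eq_true, if_false, Prod.mk.eta, one, ite2]
    simp [h, gateWeight, gateOptions]
  -- This is the other cut with the two conjugated copies exchanged.
  · have h : ∀ U, gateTerm (false, true) (isometryOfUnitary e U) α β γ δ =
        ∑ z : (κ × κ) × (κ × κ), isometryOfUnitary e U z.1 α *
      isometryOfUnitary e U z.2 β * star (isometryOfUnitary e U (z.2.1, z.1.2) δ) *
      star (isometryOfUnitary e U (z.1.1, z.2.2) γ) := by
      intro U
      simp only [gateTerm, mixPair, Bool.false_eq_true, if_false, if_true]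
      exact Finset.sum_congr rfl fun _ _ => by ring
    simp only [h, cut, gateWeight, gateOptions]
    rw [Finset.sum_pair (by decide)]
    simp [pairing, and_comm]
  · have h : ∀ U, gateTerm (true, false) (isometryOfUnitary e U) α β γ δ =
        ∑ z : (κ × κ) × (κ × κ), isometryOfUnitary e U z.1 α *
      isometryOfUnitary e U z.2 β * star (isometryOfUnitary e U (z.2.1, z.1.2) γ) *
      star (isometryOfUnitary e U (z.1.1, z.2.2) δ) := by
      intro U
      simp only [gateTerm, mixPair, Bool.false_eq_true, if_false, if_true]
    simp only [h, cut, gateWeight, gateOptions]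
    simp
  · have h : ∀ U, gateTerm (true, true) (isometryOfUnitary e U) α β γ δ =
        pairing true α β γ δ := by
      intro U
      simp only [gateTerm, mixPair, pairing, if_true, Prod.mk.eta]
      simp only [and_comm (a := γ = β), ite2, ← one U δ γ]
      exact Finset.sum_congr rfl fun _ _ => by ring
    simp [h, gateWeight, gateOptions]

@[fun_prop]
theorem continuous_gateTerm [Fintype κ] [DecidableEq κ] (e : ι ↪ κ × κ)
    (a : Bool × Bool) (α β γ δ : ι) :
    Continuous fun U => gateTerm a (isometryOfUnitary e U) α β γ δ := by
  simp only [gateTerm, isometryOfUnitary, Matrix.submatrix_apply]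
  fun_prop

theorem integral_pairPurity_gateRow [Fintype J] [DecidableEq J] [Fintype ι] [DecidableEq ι]
    [Fintype κ] [DecidableEq κ] [Nonempty κ] (e : ι ↪ κ × κ) (A : J → Bool × Bool)
    (φ : (J → ι) → ℂ) :
    ∫ U, pairPurity A (gateRow (fun j => isometryOfUnitary e (U j)) φ)
        ∂Measure.pi (fun _ : J => haarUnitary (κ × κ)) =
      (∏ j, gateWeight (Fintype.card κ) (A j) : ℝ) *
        ∑ s ∈ Fintype.piFinset fun j => gateOptions (A j), purity s φ := by
  have hc : ∀ q : (J → ι) × (J → ι) × (J → ι) × (J → ι),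
      Continuous fun U : J → Matrix.unitaryGroup (κ × κ) ℂ =>
        φ q.1 * φ q.2.1 * star (φ q.2.2.1) * star (φ q.2.2.2) *
          ∏ j, gateTerm (A j) (isometryOfUnitary e (U j)) (q.1 j) (q.2.1 j) (q.2.2.1 j)
            (q.2.2.2 j) := fun q =>
    continuous_const.mul (continuous_finsetProd _ fun j _ =>
      (continuous_gateTerm e _ _ _ _ _).comp (continuous_apply j))
  simp only [pairPurity_gateRow]
  rw [integral_finsetSum _ fun q _ => integrable_of_continuous _ (hc q)]
  simp only [integral_const_mul]
  have h : ∀ q : (J → ι) × (J → ι) × (J → ι) × (J → ι),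
      ∫ U, ∏ j, gateTerm (A j) (isometryOfUnitary e (U j)) (q.1 j) (q.2.1 j) (q.2.2.1 j)
        (q.2.2.2 j) ∂Measure.pi (fun _ : J => haarUnitary (κ × κ)) =
      (∏ j, gateWeight (Fintype.card κ) (A j) : ℝ) *
        ∑ s ∈ Fintype.piFinset fun j => gateOptions (A j),
          ∏ j, pairing (s j) (q.1 j) (q.2.1 j) (q.2.2.1 j) (q.2.2.2 j) := by
    intro q
    rw [integral_fintype_prod_eq_prod (fun j (U : Matrix.unitaryGroup (κ × κ) ℂ) =>
      gateTerm (A j) (isometryOfUnitary e U) (q.1 j) (q.2.1 j) (q.2.2.1 j) (q.2.2.2 j))]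
    simp only [integral_gateTerm, Finset.prod_mul_distrib, Finset.prod_univ_sum]
    push_cast
    rfl
  simp only [h, ← sum_prod_pairing]
  rw [Finset.sum_comm, Finset.mul_sum]
  refine Finset.sum_congr rfl fun q _ => ?_
  rw [← Finset.mul_sum]
  ring

theorem sum_norm_gateRow [Fintype J] [DecidableEq J] [Fintype ι] [DecidableEq ι]
    [Fintype κ] [DecidableEq κ] (e : ι ↪ κ × κ)
    (U : J → Matrix.unitaryGroup (κ × κ) ℂ) (φ : (J → ι) → ℂ) :
    ∑ y, gateRow (fun j => isometryOfUnitary e (U j)) φ y *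
      star (gateRow (fun j => isometryOfUnitary e (U j)) φ y) = ∑ x, φ x * star (φ x) := by
  have h : ∀ x x' : J → ι, ∑ y : J → κ × κ, ∏ j, (isometryOfUnitary e (U j) (y j) (x j) *
      star (isometryOfUnitary e (U j) (y j) (x' j))) = if x = x' then 1 else 0 := by
    intro x x'
    rw [← Fintype.piFinset_univ, ← Finset.prod_univ_sum (fun _ : J => (Finset.univ : Finset (κ × κ)))
      (fun j z => isometryOfUnitary e (U j) z (x j) * star (isometryOfUnitary e (U j) z (x' j)))]
    simp only [sum_isometry_mul_star, Finset.prod_ite_zero, Finset.prod_const_one,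
      Finset.mem_univ, true_implies, funext_iff]
  calc _ = ∑ y : J → κ × κ, ∑ x, ∑ x', φ x * star (φ x') *
        ∏ j, (isometryOfUnitary e (U j) (y j) (x j) *
      star (isometryOfUnitary e (U j) (y j) (x' j))) := by
        refine Finset.sum_congr rfl fun y _ => ?_
        simp only [gateRow, star_sum, Finset.sum_mul_sum]
        refine Finset.sum_congr rfl fun _ _ => Finset.sum_congr rfl fun _ _ => ?_
        simp only [Finset.prod_mul_distrib, star_mul', star_prod]
        ring
    _ = ∑ x, ∑ x', φ x * star (φ x') * if x = x' then 1 else 0 := by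
        rw [Finset.sum_comm]
        refine Finset.sum_congr rfl fun x _ => ?_
        rw [Finset.sum_comm]
        refine Finset.sum_congr rfl fun x' _ => ?_
        rw [← Finset.mul_sum, h]
    _ = _ := by simp

/-! The weights of all options of a row of gates add up to at most one. -/

theorem gateWeight_nonneg (D : ℕ) (a : Bool × Bool) : 0 ≤ gateWeight D a := by
  unfold gateWeight; split_ifs <;> positivity

theorem gateWeight_mul_card_le_one (D : ℕ) (a : Bool × Bool) :
    gateWeight D a * (gateOptions a).card ≤ 1 := by
  unfold gateWeight gateOptions
  split_ifs with h
  · simp [h]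
  · rw [Finset.card_pair h, div_mul_eq_mul_div, div_le_one (by positivity)]
    push_cast
    nlinarith [sq_nonneg ((D : ℝ) - 1)]

theorem gateWeight_mul_card_le_of_cut {D : ℕ} (hD : 0 < D) {a : Bool × Bool} (h : a.1 ≠ a.2) :
    gateWeight D a * (gateOptions a).card ≤ 2 / D := by
  have : (0 : ℝ) < D := by exact_mod_cast hD
  unfold gateWeight gateOptions
  rw [if_neg h, Finset.card_pair h, div_mul_eq_mul_div, div_le_div_iff₀ (by positivity) this]
  push_cast
  nlinarith

theorem sum_gateOptions_le [Fintype J] [DecidableEq J] (D : ℕ) (A : J → Bool × Bool)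
    (f : (J → Bool) → ℝ) {M : ℝ}
    (hf : ∀ s, (∀ j, s j = (A j).1 ∨ s j = (A j).2) → f s ≤ M) :
    (∏ j, gateWeight D (A j)) * ∑ s ∈ Fintype.piFinset fun j => gateOptions (A j), f s ≤
      (∏ j, gateWeight D (A j) * (gateOptions (A j)).card) * M := by
  rw [Finset.prod_mul_distrib, mul_assoc]
  refine mul_le_mul_of_nonneg_left ?_ (Finset.prod_nonneg fun j _ => gateWeight_nonneg D _)
  refine (Finset.sum_le_card_nsmul _ _ M fun s hs => hf s fun j => ?_).trans_eq ?_
  · simpa [gateOptions] using Fintype.mem_piFinset.1 hs j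
  · rw [Fintype.card_piFinset, nsmul_eq_mul]
    push_cast
    rfl

theorem prod_gateWeight_le_one [Fintype J] (D : ℕ) (A : J → Bool × Bool) :
    ∏ j, gateWeight D (A j) * (gateOptions (A j)).card ≤ 1 :=
  Finset.prod_le_one (fun _ _ => mul_nonneg (gateWeight_nonneg D _) (Nat.cast_nonneg _))
    fun _ _ => gateWeight_mul_card_le_one D _

theorem prod_gateWeight_le_of_cut [Fintype J] [DecidableEq J] {D : ℕ} (hD : 0 < D)
    (A : J → Bool × Bool) {j : J} (h : (A j).1 ≠ (A j).2) :
    ∏ j, gateWeight D (A j) * (gateOptions (A j)).card ≤ 2 / D := by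
  rw [← Finset.mul_prod_erase _ _ (Finset.mem_univ j), ← mul_one (2 / (D : ℝ))]
  refine mul_le_mul (gateWeight_mul_card_le_of_cut hD h) ?_ ?_ (by positivity)
  · exact Finset.prod_le_one
      (fun _ _ => mul_nonneg (gateWeight_nonneg D _) (Nat.cast_nonneg _))
      fun _ _ => gateWeight_mul_card_le_one D _
  · exact Finset.prod_nonneg fun _ _ => mul_nonneg (gateWeight_nonneg D _) (Nat.cast_nonneg _)

end Purity

/-! ### Grouping the sites of a ring into pairs -/

section Pairs

variable {S J κ ι : Type*} {e₀ e₁ : J → S}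

/-- Configurations of sites as configurations of pairs of sites. -/
def pairEquiv (h : Function.Bijective (Sum.elim e₀ e₁)) : (S → κ) ≃ (J → κ × κ) :=
  ((Equiv.arrowCongr (Equiv.ofBijective _ h).symm (Equiv.refl κ)).trans
    (Equiv.sumArrowEquivProdArrow J J κ)).trans
    (Equiv.arrowProdEquivProdArrow J (fun _ => κ) (fun _ => κ)).symm

theorem pairEquiv_apply (h : Function.Bijective (Sum.elim e₀ e₁)) (y : S → κ) :
    pairEquiv h y = fun j => (y (e₀ j), y (e₁ j)) := rfl

theorem purity_comp_pairEquiv [Fintype S] [DecidableEq S] [Fintype J] [DecidableEq J] [Fintype κ]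
    (h : Function.Bijective (Sum.elim e₀ e₁)) (A : S → Bool) (χ : (J → κ × κ) → ℂ) :
    purity A (fun y => χ (pairEquiv h y)) = pairPurity (fun j => (A (e₀ j), A (e₁ j))) χ := by
  simp only [purity, pairPurity]
  rw [← Equiv.sum_comp (pairEquiv h)]
  refine Finset.sum_congr rfl fun x _ => ?_
  rw [← Equiv.sum_comp (pairEquiv h)]
  rfl

/-- The set of sites whose pairs are selected by `s`. -/
def unpair (h : Function.Bijective (Sum.elim e₀ e₁)) (s : J → Bool) : S → Bool :=
  (pairEquiv h).symm fun j => (s j, s j)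

theorem unpair_fst (h : Function.Bijective (Sum.elim e₀ e₁)) (s : J → Bool) (j : J) :
    unpair h s (e₀ j) = s j :=
  congrArg Prod.fst (congrFun ((pairEquiv h).apply_symm_apply fun j => (s j, s j)) j)

theorem unpair_snd (h : Function.Bijective (Sum.elim e₀ e₁)) (s : J → Bool) (j : J) :
    unpair h s (e₁ j) = s j :=
  congrArg Prod.snd (congrFun ((pairEquiv h).apply_symm_apply fun j => (s j, s j)) j)

theorem purity_comp_pairEquiv_symm [Fintype S] [DecidableEq S] [Fintype J] [DecidableEq J]
    [Fintype κ] (h : Function.Bijective (Sum.elim e₀ e₁)) (s : J → Bool) (φ : (S → κ) → ℂ) :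
    purity s (fun x => φ ((pairEquiv h).symm x)) = purity (unpair h s) φ := by
  have hm : ∀ x y : S → κ, (pairEquiv h).symm (mix s (pairEquiv h x) (pairEquiv h y)) =
      mix (unpair h s) x y := by
    intro x y
    rw [Equiv.symm_apply_eq]
    funext j
    simp only [mix, pairEquiv_apply, unpair_fst, unpair_snd]
    split_ifs <;> rfl
  simp only [purity]
  rw [← Equiv.sum_comp (pairEquiv h)]
  refine Finset.sum_congr rfl fun x _ => ?_
  rw [← Equiv.sum_comp (pairEquiv h)]
  simp only [hm, Equiv.symm_apply_apply]

end Pairs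

/-! ### Rows of `V` and `W` on the ring -/

theorem even_odd_bijective (k : ℕ) : Function.Bijective (Sum.elim (evenSite k) (oddSite k)) := by
  rw [Fintype.bijective_iff_injective_and_card]
  refine ⟨?_, by simp [pow_succ]; ring⟩
  rintro (i | i) (j | j) h <;> (simp [evenSite, oddSite] at h ⊢; omega)

theorem nextEvenSite_val (k : ℕ) (j : Fin (2 ^ k)) :
    (nextEvenSite k j).val = if j.val + 1 < 2 ^ k then 2 * j.val + 2 else 0 := by
  have hj := j.isLt
  simp only [nextEvenSite]
  split_ifs with h
  · exact Nat.mod_eq_of_lt (by rw [pow_succ]; omega)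
  · have : 2 * j.val + 2 = 2 ^ (k + 1) := by rw [pow_succ]; omega
    rw [this, Nat.mod_self]

theorem odd_nextEven_bijective (k : ℕ) :
    Function.Bijective (Sum.elim (oddSite k) (nextEvenSite k)) := by
  rw [Fintype.bijective_iff_injective_and_card]
  refine ⟨?_, by simp [pow_succ]; ring⟩
  have key : ∀ i j : Fin (2 ^ k), oddSite k i ≠ nextEvenSite k j := by
    intro i j h
    have h := congrArg Fin.val h
    rw [nextEvenSite_val] at h
    simp only [oddSite] at h
    split_ifs at h
    omega
  rintro (i | i) (j | j) h <;> simp only [Sum.elim_inl, Sum.elim_inr] at h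
  · have h := congrArg Fin.val h
    simp only [oddSite] at h
    rw [Fin.ext (by omega : i.val = j.val)]
  · exact (key _ _ h).elim
  · exact (key _ _ h.symm).elim
  · have h := congrArg Fin.val h
    rw [nextEvenSite_val, nextEvenSite_val] at h
    have hi := i.isLt
    have hj := j.isLt
    rw [Fin.ext (by split_ifs at h <;> omega : i.val = j.val)]

/-- The set of sites selected by options for the gates of a row of `W`. -/
def unpairW (k : ℕ) (s : Fin (2 ^ k) → Bool) : Fin (2 ^ (k + 1)) → Bool :=
  unpair (odd_nextEven_bijective k) s

theorem applyV_eq_gateRow (k : ℕ) {d d' : ℕ} (V : Fin (2 ^ k) → Matrix (Fin d' × Fin d') (Fin d) ℂ)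
    (φ : (Fin (2 ^ k) → Fin d) → ℂ) :
    applyV k V φ = fun y => gateRow V φ (pairEquiv (even_odd_bijective k) y) := rfl

theorem applyW_eq_gateRow (k : ℕ) {d d' : ℕ}
    (W : Fin (2 ^ k) → Matrix (Fin d × Fin d) (Fin d' × Fin d') ℂ)
    (φ : (Fin (2 ^ (k + 1)) → Fin d') → ℂ) :
    applyW k W φ = fun y => gateRow W (fun x => φ ((pairEquiv (odd_nextEven_bijective k)).symm x))
      (pairEquiv (odd_nextEven_bijective k) y) := by
  funext y
  simp only [applyW, gateRow]
  rw [← Equiv.sum_comp (pairEquiv (odd_nextEven_bijective k))]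
  simp only [Equiv.symm_apply_apply]
  rfl

theorem integral_purity_applyV (k : ℕ) {d d' : ℕ} (hd : 0 < d') (e : Fin d ↪ Fin d' × Fin d')
    (A : Fin (2 ^ (k + 1)) → Bool) (φ : (Fin (2 ^ k) → Fin d) → ℂ) :
    ∫ U, purity A (applyV k (fun j => isometryOfUnitary e (U j)) φ)
        ∂Measure.pi (fun _ => haarUnitary (Fin d' × Fin d')) =
      (∏ j, gateWeight d' (A (evenSite k j), A (oddSite k j)) : ℝ) *
        ∑ s ∈ Fintype.piFinset fun j => gateOptions (A (evenSite k j), A (oddSite k j)),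
          purity s φ := by
  have : Nonempty (Fin d') := ⟨⟨0, hd⟩⟩
  simp only [applyV_eq_gateRow, purity_comp_pairEquiv]
  rw [integral_pairPurity_gateRow, Fintype.card_fin]

theorem integral_purity_applyW (k : ℕ) {d d' : ℕ} (hd : 0 < d)
    (e : Fin d' × Fin d' ↪ Fin d × Fin d)
    (A : Fin (2 ^ (k + 1)) → Bool) (φ : (Fin (2 ^ (k + 1)) → Fin d') → ℂ) :
    ∫ U, purity A (applyW k (fun j => isometryOfUnitary e (U j)) φ)
        ∂Measure.pi (fun _ => haarUnitary (Fin d × Fin d)) =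
      (∏ j, gateWeight d (A (oddSite k j), A (nextEvenSite k j)) : ℝ) *
        ∑ s ∈ Fintype.piFinset fun j => gateOptions (A (oddSite k j), A (nextEvenSite k j)),
          purity (unpairW k s) φ := by
  have : Nonempty (Fin d) := ⟨⟨0, hd⟩⟩
  simp only [applyW_eq_gateRow, purity_comp_pairEquiv]
  rw [integral_pairPurity_gateRow, Fintype.card_fin]
  simp only [purity_comp_pairEquiv_symm]
  rfl

theorem sum_norm_applyV (k : ℕ) {d d' : ℕ} (e : Fin d ↪ Fin d' × Fin d')
    (U : Fin (2 ^ k) → Matrix.unitaryGroup (Fin d' × Fin d') ℂ) (φ : (Fin (2 ^ k) → Fin d) → ℂ) :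
    ∑ y, applyV k (fun j => isometryOfUnitary e (U j)) φ y *
      star (applyV k (fun j => isometryOfUnitary e (U j)) φ y) = ∑ x, φ x * star (φ x) := by
  rw [← sum_norm_gateRow e U φ, ← Equiv.sum_comp (pairEquiv (even_odd_bijective k))]
  rfl

theorem sum_norm_applyW (k : ℕ) {d d' : ℕ} (e : Fin d' × Fin d' ↪ Fin d × Fin d)
    (U : Fin (2 ^ k) → Matrix.unitaryGroup (Fin d × Fin d) ℂ)
    (φ : (Fin (2 ^ (k + 1)) → Fin d') → ℂ) :
    ∑ y, applyW k (fun j => isometryOfUnitary e (U j)) φ y *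
      star (applyW k (fun j => isometryOfUnitary e (U j)) φ y) = ∑ x, φ x * star (φ x) := by
  rw [applyW_eq_gateRow, Equiv.sum_comp (pairEquiv (odd_nextEven_bijective k)) fun y =>
    gateRow (fun j => isometryOfUnitary e (U j)) _ y * star (gateRow _ _ y), sum_norm_gateRow,
    ← Equiv.sum_comp (pairEquiv (odd_nextEven_bijective k))]
  simp only [Equiv.symm_apply_apply]

/-! ### Resampling one component of a product measure -/

section Resample

variable {ι : Type*} [Fintype ι] [DecidableEq ι]

/-- Independence: a fresh sample of one coordinate leaves the law unchanged. This replaces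
conditioning on the other coordinates. -/
theorem measurePreserving_update {E : ι → Type*} [∀ i, MeasurableSpace (E i)]
    (μ : ∀ i, Measure (E i)) [∀ i, IsProbabilityMeasure (μ i)] (k : ι) :
    MeasurePreserving (fun p : (∀ i, E i) × E k => Function.update p.1 k p.2)
      ((Measure.pi μ).prod (μ k)) (Measure.pi μ) := by
  refine ⟨measurable_update', (Measure.pi_eq fun s hs => ?_).symm⟩
  rw [Measure.map_apply measurable_update' (MeasurableSet.univ_pi hs)]
  have h : (fun p : (∀ i, E i) × E k => Function.update p.1 k p.2) ⁻¹' Set.univ.pi s =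
      (Set.univ.pi (Function.update s k Set.univ)) ×ˢ s k := by
    ext ⟨x, u⟩
    simp only [Set.mem_preimage, Set.mem_pi, Set.mem_univ, true_implies, Set.mem_prod]
    constructor
    · intro h
      refine ⟨fun i => ?_, by simpa using h k⟩
      by_cases hi : i = k
      · subst hi; simp
      · simpa [hi] using h i
    · rintro ⟨h, hu⟩ i
      by_cases hi : i = k
      · subst hi; simpa using hu
      · simpa [hi] using h i
  rw [h, Measure.prod_prod, Measure.pi_pi, ← Finset.prod_erase_mul _ _ (Finset.mem_univ k),
    ← Finset.prod_erase_mul _ _ (Finset.mem_univ k)]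
  simp only [Function.update_self, measure_univ, mul_one]
  congr 1
  refine Finset.prod_congr rfl fun i hi => ?_
  rw [Function.update_of_ne (Finset.ne_of_mem_erase hi)]

theorem integral_resample {E : ι → Type*} [∀ i, MeasurableSpace (E i)]
    (μ : ∀ i, Measure (E i)) [∀ i, IsProbabilityMeasure (μ i)] (k : ι) {f : (∀ i, E i) → ℂ}
    (hf : StronglyMeasurable f) {C : ℝ} (hC : ∀ x, ‖f x‖ ≤ C) :
    ∫ x, f x ∂Measure.pi μ = ∫ x, ∫ u, f (Function.update x k u) ∂μ k ∂Measure.pi μ := by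
  have h := measurePreserving_update μ k
  rw [← h.map_eq, integral_map h.measurable.aemeasurable
    (by rw [h.map_eq]; exact hf.aestronglyMeasurable), h.map_eq, integral_prod]
  exact Integrable.of_bound (hf.comp_measurable h.measurable).aestronglyMeasurable C
    (Filter.Eventually.of_forall fun x => hC _)

variable {E F : ι → Type*} [∀ i, MeasurableSpace (E i)] [∀ i, MeasurableSpace (F i)]
  (μ : ∀ i, Measure (E i)) (ν : ∀ i, Measure (F i)) [∀ i, IsProbabilityMeasure (μ i)]
  [∀ i, IsProbabilityMeasure (ν i)] (k : ι) {f : (∀ i, E i × F i) → ℂ}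

/-- Resampling the whole coordinate `k` on both sides reduces the claim to Fubini, since the inner
average no longer depends on the second factor. -/
theorem integral_resample_snd (hf : StronglyMeasurable f) {C : ℝ} (hC : ∀ x, ‖f x‖ ≤ C) :
    ∫ x, f x ∂Measure.pi (fun i => (μ i).prod (ν i)) =
      ∫ x, ∫ w, f (Function.update x k ((x k).1, w)) ∂ν k
        ∂Measure.pi (fun i => (μ i).prod (ν i)) := by
  have hm : Measurable fun p : (∀ i, E i × F i) × F k =>
      Function.update p.1 k ((p.1 k).1, p.2) :=
    measurable_update'.comp (measurable_fst.prodMk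
      ((measurable_fst.comp ((measurable_pi_apply k).comp measurable_fst)).prodMk measurable_snd))
  have hm' : ∀ x : ∀ i, E i × F i, Measurable fun u : E k × F k => Function.update x k u :=
    fun x => measurable_update x
  rw [integral_resample _ k hf hC, integral_resample _ k
    (f := fun x => ∫ w, f (Function.update x k ((x k).1, w)) ∂ν k)
    (hf.comp_measurable hm).integral_prod_right' (C := C)
    fun x => (norm_integral_le_of_norm_le_const (Filter.Eventually.of_forall fun w => hC _)).trans
      (by simp)]
  congr 1
  funext x
  simp only [Function.update_idem, Function.update_self]
  have hi : Integrable (fun u => f (Function.update x k u)) ((μ k).prod (ν k)) :=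
    Integrable.of_bound (hf.comp_measurable (hm' x)).aestronglyMeasurable C
      (Filter.Eventually.of_forall fun x => hC _)
  rw [integral_prod _ hi,
    integral_prod _ (Integrable.of_bound (C := C) ?_
    (Filter.Eventually.of_forall fun u => (norm_integral_le_of_norm_le_const
      (Filter.Eventually.of_forall fun w => hC _)).trans (by simp)))]
  · simp
  · have h2 : StronglyMeasurable fun u : E k => ∫ w, f (Function.update x k (u, w)) ∂ν k :=
      (hf.comp_measurable (hm' x)).integral_prod_right'
    exact (h2.comp_measurable measurable_fst).aestronglyMeasurable

theorem integral_resample_fst (hf : StronglyMeasurable f) {C : ℝ} (hC : ∀ x, ‖f x‖ ≤ C) :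
    ∫ x, f x ∂Measure.pi (fun i => (μ i).prod (ν i)) =
      ∫ x, ∫ v, f (Function.update x k (v, (x k).2)) ∂μ k
        ∂Measure.pi (fun i => (μ i).prod (ν i)) := by
  have hm : Measurable fun p : (∀ i, E i × F i) × E k =>
      Function.update p.1 k (p.2, (p.1 k).2) :=
    measurable_update'.comp (measurable_fst.prodMk
      (measurable_snd.prodMk (measurable_snd.comp ((measurable_pi_apply k).comp measurable_fst))))
  have hm' : ∀ x : ∀ i, E i × F i, Measurable fun u : E k × F k => Function.update x k u :=
    fun x => measurable_update x
  rw [integral_resample _ k hf hC, integral_resample _ k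
    (f := fun x => ∫ v, f (Function.update x k (v, (x k).2)) ∂μ k)
    (hf.comp_measurable hm).integral_prod_right' (C := C)
    fun x => (norm_integral_le_of_norm_le_const (Filter.Eventually.of_forall fun w => hC _)).trans
      (by simp)]
  congr 1
  funext x
  simp only [Function.update_idem, Function.update_self]
  have hi : Integrable (fun u => f (Function.update x k u)) ((μ k).prod (ν k)) :=
    Integrable.of_bound (hf.comp_measurable (hm' x)).aestronglyMeasurable C
      (Filter.Eventually.of_forall fun x => hC _)
  rw [integral_prod_symm _ hi,
    integral_prod_symm _ (Integrable.of_bound (C := C) ?_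
    (Filter.Eventually.of_forall fun u => (norm_integral_le_of_norm_le_const
      (Filter.Eventually.of_forall fun w => hC _)).trans (by simp)))]
  · simp
  · have h2 : StronglyMeasurable fun w : F k => ∫ v, f (Function.update x k (v, w)) ∂μ k :=
      (hf.comp_measurable (hm' x)).integral_prod_left'
    exact (h2.comp_measurable measurable_snd).aestronglyMeasurable

end Resample

/-! ### The expected purities of the random states -/

section Recursion

variable {L : ℕ}

instance instIsProbabilityMeasureLaw (B : Dims L) : IsProbabilityMeasure (law B) := by
  unfold law; infer_instance

theorem continuous_isoV (B : Dims L) (k : Fin L) (j : Fin (2 ^ k.val)) (a b) :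
    Continuous fun ω : Sample B => isoV B ω k j a b :=
  (continuous_unitary_entry _ _).comp
    ((continuous_apply j).comp (continuous_fst.comp (continuous_apply k)))

theorem continuous_isoW (B : Dims L) (k : Fin L) (j : Fin (2 ^ k.val)) (a b) :
    Continuous fun ω : Sample B => isoW B ω k j a b :=
  (continuous_unitary_entry _ _).comp
    ((continuous_apply j).comp (continuous_snd.comp (continuous_apply k)))

theorem continuous_phi_of_psi (B : Dims L) (k : ℕ) (hk : k + 1 ≤ L)
    (h : ∀ y, Continuous fun ω => psi B ω k (Nat.le_of_succ_le hk) y) (y) :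
    Continuous fun ω => phi B ω (k + 1) hk y :=
  continuous_finsetSum _ fun x _ => (continuous_finsetProd _ fun j _ =>
    continuous_isoV B ⟨k, hk⟩ j _ _).mul (h x)

theorem continuous_psi (B : Dims L) : ∀ (k : ℕ) (hk : k ≤ L) (y),
    Continuous fun ω => psi B ω k hk y
  | 0, _, _ => continuous_const
  | k + 1, hk, _ => continuous_finsetSum _ fun x _ => (continuous_finsetProd _ fun j _ =>
      continuous_isoW B ⟨k, hk⟩ j _ _).mul
        (continuous_phi_of_psi B k hk (continuous_psi B k (Nat.le_of_succ_le hk)) x)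

theorem continuous_phi (B : Dims L) (k : ℕ) (hk : k + 1 ≤ L) (y) :
    Continuous fun ω => phi B ω (k + 1) hk y :=
  continuous_phi_of_psi B k hk (continuous_psi B k _) y

theorem continuous_purity {X S ι : Type*} [TopologicalSpace X] [Fintype S] [DecidableEq S]
    [Fintype ι] (A : S → Bool) {φ : X → (S → ι) → ℂ} (h : ∀ y, Continuous fun ω => φ ω y) :
    Continuous fun ω => purity A (φ ω) := by
  unfold purity
  exact continuous_finsetSum _ fun x _ => continuous_finsetSum _ fun y _ =>
    (((h _).mul (h _)).mul (h _).star).mul (h _).star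

/-- The state at level `k` involves only gates of index below `k`, so a later row can be averaged
with its input held fixed. -/
theorem psi_update (B : Dims L) (ω : Sample B) (i : Fin L) (u) : ∀ (k : ℕ) (hk : k ≤ L),
    k ≤ i.val → psi B (Function.update ω i u) k hk = psi B ω k hk
  | 0, _, _ => rfl
  | k + 1, hk, hi => by
    have h : (⟨k, hk⟩ : Fin L) ≠ i := fun h => by
      have := congrArg Fin.val h
      simp at this
      omega
    have h1 : isoV B (Function.update ω i u) ⟨k, hk⟩ = isoV B ω ⟨k, hk⟩ := by
      funext j
      rw [isoV, isoV, Function.update_of_ne h]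
    have h2 : isoW B (Function.update ω i u) ⟨k, hk⟩ = isoW B ω ⟨k, hk⟩ := by
      funext j
      rw [isoW, isoW, Function.update_of_ne h]
    rw [psi, psi, h1, h2, psi_update B ω i u k _ (by omega)]

theorem norm_le_of_continuous {X : Type*} [TopologicalSpace X] [CompactSpace X] {f : X → ℂ}
    (hf : Continuous f) : ∃ C, ∀ x, ‖f x‖ ≤ C := by
  obtain ⟨C, hC⟩ := (isCompact_range hf).isBounded.exists_norm_le
  exact ⟨C, fun x => hC _ ⟨x, rfl⟩⟩

/-- Expected purity of a set of sites in the state `ψ(k)`. -/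
def sigmaPurity (B : Dims L) (k : ℕ) (hk : k ≤ L) (A : Fin (2 ^ k) → Bool) : ℝ :=
  (∫ ω, purity A (psi B ω k hk) ∂law B).re

/-- Expected purity of a set of sites in the state `φ(k)`. -/
def tauPurity (B : Dims L) (k : ℕ) (hk : k ≤ L) (A : Fin (2 ^ k) → Bool) : ℝ :=
  (∫ ω, purity A (phi B ω k hk) ∂law B).re

/-- Resampling the last row `W` does not affect its input `phi`, so the one-row average applies
inside the expectation. -/
theorem sigmaPurity_succ (B : Dims L) (k : ℕ) (hk : k + 1 ≤ L) (hD : 0 < B.D (k + 1))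
    (A : Fin (2 ^ (k + 1)) → Bool) :
    sigmaPurity B (k + 1) hk A =
      (∏ j, gateWeight (B.D (k + 1)) (A (oddSite k j), A (nextEvenSite k j))) *
        ∑ s ∈ Fintype.piFinset fun j => gateOptions (A (oddSite k j), A (nextEvenSite k j)),
          tauPurity B (k + 1) hk (unpairW k s) := by
  have hc := continuous_purity A (continuous_psi B (k + 1) hk)
  obtain ⟨C, hC⟩ := norm_le_of_continuous hc
  have h1 := integral_resample_snd
    (fun i : Fin L => Measure.pi fun _ : Fin (2 ^ i.val) =>
      haarUnitary (Fin (B.D' (i.val + 1)) × Fin (B.D' (i.val + 1))))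
    (fun i : Fin L => Measure.pi fun _ : Fin (2 ^ i.val) =>
      haarUnitary (Fin (B.D (i.val + 1)) × Fin (B.D (i.val + 1))))
    (⟨k, hk⟩ : Fin L) hc.stronglyMeasurable hC
  have h2 : ∀ (ω : Sample B) w, purity A (psi B (Function.update ω ⟨k, hk⟩
      ((ω ⟨k, hk⟩).1, w)) (k + 1) hk) =
      purity A (applyW k (fun j => isometryOfUnitary ((Fin.castLEEmb (B.hW k hk)).prodMap
        (Fin.castLEEmb (B.hW k hk))) (w j)) (phi B ω (k + 1) hk)) := by
    intro ω w
    have e1 : isoV B (Function.update ω ⟨k, hk⟩ ((ω ⟨k, hk⟩).1, w)) ⟨k, hk⟩ =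
        isoV B ω ⟨k, hk⟩ := by
      funext j
      rw [isoV, isoV, Function.update_self]
    rw [psi, psi_update _ _ _ _ _ _ le_rfl, e1, phi]
    congr 2
    funext j
    rw [isoW, Function.update_self]
  simp only [h2] at h1
  simp only [integral_purity_applyW k hD] at h1
  rw [integral_const_mul, integral_finsetSum _ fun s _ => integrable_of_continuous _
    (continuous_purity _ (continuous_phi B k hk))] at h1
  simp only [sigmaPurity, tauPurity, law]
  rw [h1, Complex.re_ofReal_mul, Complex.re_sum]

theorem tauPurity_succ (B : Dims L) (k : ℕ) (hk : k + 1 ≤ L) (hD : 0 < B.D' (k + 1))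
    (A : Fin (2 ^ (k + 1)) → Bool) :
    tauPurity B (k + 1) hk A =
      (∏ j, gateWeight (B.D' (k + 1)) (A (evenSite k j), A (oddSite k j))) *
        ∑ s ∈ Fintype.piFinset fun j => gateOptions (A (evenSite k j), A (oddSite k j)),
          sigmaPurity B k (Nat.le_of_succ_le hk) s := by
  have hc := continuous_purity A (continuous_phi B k hk)
  obtain ⟨C, hC⟩ := norm_le_of_continuous hc
  have h1 := integral_resample_fst
    (fun i : Fin L => Measure.pi fun _ : Fin (2 ^ i.val) =>
      haarUnitary (Fin (B.D' (i.val + 1)) × Fin (B.D' (i.val + 1))))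
    (fun i : Fin L => Measure.pi fun _ : Fin (2 ^ i.val) =>
      haarUnitary (Fin (B.D (i.val + 1)) × Fin (B.D (i.val + 1))))
    (⟨k, hk⟩ : Fin L) hc.stronglyMeasurable hC
  have h2 : ∀ (ω : Sample B) v, purity A (phi B (Function.update ω ⟨k, hk⟩
      (v, (ω ⟨k, hk⟩).2)) (k + 1) hk) =
      purity A (applyV k (fun j => isometryOfUnitary ((Fin.castLEEmb (B.hV k hk)).trans
        finProdFinEquiv.symm.toEmbedding) (v j)) (psi B ω k (Nat.le_of_succ_le hk))) := by
    intro ω v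
    rw [phi, psi_update _ _ _ _ _ _ le_rfl]
    congr 2
    funext j
    rw [isoV, Function.update_self]
  simp only [h2] at h1
  simp only [integral_purity_applyV k hD] at h1
  rw [integral_const_mul, integral_finsetSum _ fun s _ => integrable_of_continuous _
    (continuous_purity _ (continuous_psi B k _))] at h1
  simp only [sigmaPurity, tauPurity, law]
  rw [h1, Complex.re_ofReal_mul, Complex.re_sum]

theorem sigmaPurity_zero (B : Dims L) (A : Fin (2 ^ 0) → Bool) :
    sigmaPurity B 0 (Nat.zero_le L) A = 1 := by
  simp [sigmaPurity, purity, psi, B.top]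

theorem sum_norm_phi_of_psi (B : Dims L) (ω : Sample B) (k : ℕ) (hk : k + 1 ≤ L)
    (h : ∑ y, psi B ω k (Nat.le_of_succ_le hk) y * star (psi B ω k (Nat.le_of_succ_le hk) y) = 1) :
    ∑ y, phi B ω (k + 1) hk y * star (phi B ω (k + 1) hk y) = 1 :=
  (sum_norm_applyV k _ _ _).trans h

theorem sum_norm_psi (B : Dims L) (ω : Sample B) : ∀ (k : ℕ) (hk : k ≤ L),
    ∑ y, psi B ω k hk y * star (psi B ω k hk y) = 1
  | 0, _ => by simp [psi, B.top]
  | k + 1, hk => (sum_norm_applyW k _ _ _).trans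
      (sum_norm_phi_of_psi B ω k hk (sum_norm_psi B ω k _))

theorem sum_norm_phi (B : Dims L) (ω : Sample B) (k : ℕ) (hk : k + 1 ≤ L) :
    ∑ y, phi B ω (k + 1) hk y * star (phi B ω (k + 1) hk y) = 1 :=
  sum_norm_phi_of_psi B ω k hk (sum_norm_psi B ω k _)

/-! ### Bounds from the recursion -/

variable (B : Dims L)

/-- `C` is obtained from `A` by giving each pair of sites acted on by `W` one of the two colours
that its sites have in `A`. -/
def IsWOption (k : ℕ) (A C : Fin (2 ^ (k + 1)) → Bool) : Prop :=
  ∀ j, (C (oddSite k j) = A (oddSite k j) ∨ C (oddSite k j) = A (nextEvenSite k j)) ∧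
    C (nextEvenSite k j) = C (oddSite k j)

/-- `C` is obtained from `A` by giving each site one of the two colours that its images under `V`
have in `A`. -/
def IsVOption (k : ℕ) (A : Fin (2 ^ (k + 1)) → Bool) (C : Fin (2 ^ k) → Bool) : Prop :=
  ∀ j, C j = A (evenSite k j) ∨ C j = A (oddSite k j)

theorem isWOption_unpairW {k : ℕ} {A : Fin (2 ^ (k + 1)) → Bool} {s : Fin (2 ^ k) → Bool}
    (h : ∀ j, s j = A (oddSite k j) ∨ s j = A (nextEvenSite k j)) :
    IsWOption k A (unpairW k s) := fun j => by
  have h1 : unpairW k s (oddSite k j) = s j := unpair_fst _ s j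
  have h2 : unpairW k s (nextEvenSite k j) = s j := unpair_snd _ s j
  rw [h1, h2]
  exact ⟨h j, rfl⟩

/-- The weights of the options total at most one, possibly less, which is why `M` must be
nonnegative. -/
theorem sigmaPurity_succ_le (k : ℕ) (hk : k + 1 ≤ L) (hD : 0 < B.D (k + 1))
    (A : Fin (2 ^ (k + 1)) → Bool) {M : ℝ} (hM : 0 ≤ M)
    (h : ∀ C, IsWOption k A C → tauPurity B (k + 1) hk C ≤ M) :
    sigmaPurity B (k + 1) hk A ≤ M := by
  rw [sigmaPurity_succ B k hk hD]
  refine (sum_gateOptions_le _ _ _ fun s hs => h _ (isWOption_unpairW hs)).trans ?_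
  exact mul_le_of_le_one_left hM (prod_gateWeight_le_one _ _)

theorem tauPurity_succ_le (k : ℕ) (hk : k + 1 ≤ L) (hD : 0 < B.D' (k + 1))
    (A : Fin (2 ^ (k + 1)) → Bool) {M : ℝ} (hM : 0 ≤ M)
    (h : ∀ C, IsVOption k A C → sigmaPurity B k (Nat.le_of_succ_le hk) C ≤ M) :
    tauPurity B (k + 1) hk A ≤ M := by
  rw [tauPurity_succ B k hk hD]
  refine (sum_gateOptions_le _ _ _ h).trans ?_
  exact mul_le_of_le_one_left hM (prod_gateWeight_le_one _ _)

variable {B}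

theorem sigmaPurity_le_one (hB : ∀ k, 0 < B.D k) (hB' : ∀ k, 0 < B.D' k) : ∀ (k : ℕ) (hk : k ≤ L)
    (A : Fin (2 ^ k) → Bool), sigmaPurity B k hk A ≤ 1
  | 0, _, A => (sigmaPurity_zero B A).le
  | k + 1, hk, A => sigmaPurity_succ_le B k hk (hB _) A zero_le_one fun C _ =>
      tauPurity_succ_le B k hk (hB' _) C zero_le_one fun E _ =>
        sigmaPurity_le_one hB hB' k _ E

theorem tauPurity_le_one (hB : ∀ k, 0 < B.D k) (hB' : ∀ k, 0 < B.D' k) (k : ℕ) (hk : k + 1 ≤ L)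
    (A : Fin (2 ^ (k + 1)) → Bool) : tauPurity B (k + 1) hk A ≤ 1 :=
  tauPurity_succ_le B k hk (hB' _) A zero_le_one fun E _ => sigmaPurity_le_one hB hB' k _ E

/-- The cut gate supplies `2 / D`; all other gates, and the purities one row up, are bounded by one.
-/
theorem sigmaPurity_succ_le_of_cut (hB : ∀ k, 0 < B.D k) (hB' : ∀ k, 0 < B.D' k)
    (k : ℕ) (hk : k + 1 ≤ L) (A : Fin (2 ^ (k + 1)) → Bool)
    {j : Fin (2 ^ k)} (hj : A (oddSite k j) ≠ A (nextEvenSite k j)) :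
    sigmaPurity B (k + 1) hk A ≤ 2 / B.D (k + 1) := by
  rw [sigmaPurity_succ B k hk (hB _)]
  refine (sum_gateOptions_le _ _ _ fun s hs => tauPurity_le_one hB hB' k hk _).trans ?_
  rw [mul_one]
  exact prod_gateWeight_le_of_cut (hB _) _ (j := j) hj

theorem tauPurity_succ_le_of_cut (hB : ∀ k, 0 < B.D k) (hB' : ∀ k, 0 < B.D' k)
    (k : ℕ) (hk : k + 1 ≤ L) (A : Fin (2 ^ (k + 1)) → Bool)
    {j : Fin (2 ^ k)} (hj : A (evenSite k j) ≠ A (oddSite k j)) :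
    tauPurity B (k + 1) hk A ≤ 2 / B.D' (k + 1) := by
  rw [tauPurity_succ B k hk (hB' _)]
  refine (sum_gateOptions_le _ _ _ fun s hs => sigmaPurity_le_one hB hB' k _ _).trans ?_
  rw [mul_one]
  exact prod_gateWeight_le_of_cut (hB' _) _ (j := j) hj

end Recursion

/-! ### Runs of equal colour -/

section Runs

/-- The colour of site `n` modulo `2 ^ k`. -/
def colourAt {k : ℕ} (A : Fin (2 ^ k) → Bool) (n : ℕ) : Bool :=
  A ⟨n % 2 ^ k, Nat.mod_lt _ (by positivity)⟩

/-- `A` contains `r` consecutive sites of colour `b`. -/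
def HasRun {k : ℕ} (A : Fin (2 ^ k) → Bool) (b : Bool) (r : ℕ) : Prop :=
  ∃ p, ∀ t < r, colourAt A (p + t) = b

theorem HasRun.mono {k : ℕ} {A : Fin (2 ^ k) → Bool} {b : Bool} {r r' : ℕ} (h : HasRun A b r)
    (hr : r' ≤ r) : HasRun A b r' :=
  h.imp fun _ h t ht => h t (ht.trans_le hr)

theorem colourAt_even {k : ℕ} (A : Fin (2 ^ (k + 1)) → Bool) (n : ℕ) :
    colourAt A (2 * n) = A (evenSite k ⟨n % 2 ^ k, Nat.mod_lt _ (by positivity)⟩) := by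
  unfold colourAt evenSite
  congr 1
  ext
  simp only [pow_succ']
  exact Nat.mul_mod_mul_left 2 n (2 ^ k)

theorem colourAt_odd {k : ℕ} (A : Fin (2 ^ (k + 1)) → Bool) (n : ℕ) :
    colourAt A (2 * n + 1) = A (oddSite k ⟨n % 2 ^ k, Nat.mod_lt _ (by positivity)⟩) := by
  unfold colourAt oddSite
  congr 1
  ext
  have hlt : n % 2 ^ k < 2 ^ k := Nat.mod_lt _ (by positivity)
  simp only [pow_succ']
  rw [Nat.add_mod, Nat.mul_mod_mul_left, Nat.mod_eq_of_lt (a := 1)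
    (by have : 0 < 2 ^ k := by positivity
        omega), Nat.mod_eq_of_lt (by omega)]

theorem colourAt_nextEven {k : ℕ} (A : Fin (2 ^ (k + 1)) → Bool) (n : ℕ) :
    colourAt A (2 * n + 2) = A (nextEvenSite k ⟨n % 2 ^ k, Nat.mod_lt _ (by positivity)⟩) := by
  unfold colourAt nextEvenSite
  congr 1
  ext
  simp only [pow_succ']
  rw [show 2 * n + 2 = 2 * (n + 1) by ring, show 2 * (n % 2 ^ k) + 2 = 2 * (n % 2 ^ k + 1) by ring,
    Nat.mul_mod_mul_left, Nat.mul_mod_mul_left, Nat.mod_add_mod]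

variable {k : ℕ} {A : Fin (2 ^ (k + 1)) → Bool} {b : Bool} {r : ℕ}

theorem IsVOption.colourAt {C : Fin (2 ^ k) → Bool} (h : IsVOption k A C) {n : ℕ}
    (h₀ : colourAt A (2 * n) = b) (h₁ : colourAt A (2 * n + 1) = b) :
    RandomMERA.colourAt C n = b := by
  rw [colourAt_even] at h₀
  rw [colourAt_odd] at h₁
  rcases h ⟨n % 2 ^ k, Nat.mod_lt _ (by positivity)⟩ with h | h
  · exact h.trans h₀
  · exact h.trans h₁

theorem IsWOption.colourAt {C : Fin (2 ^ (k + 1)) → Bool} (h : IsWOption k A C) {n : ℕ}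
    (h₁ : colourAt A (2 * n + 1) = b) (h₂ : colourAt A (2 * n + 2) = b) :
    RandomMERA.colourAt C (2 * n + 1) = b ∧ RandomMERA.colourAt C (2 * n + 2) = b := by
  rw [colourAt_odd] at h₁ ⊢
  rw [colourAt_nextEven] at h₂ ⊢
  obtain ⟨h, h'⟩ := h ⟨n % 2 ^ k, Nat.mod_lt _ (by positivity)⟩
  rw [h']
  rcases h with h | h
  · exact ⟨h.trans h₁, h.trans h₁⟩
  · exact ⟨h.trans h₂, h.trans h₂⟩

theorem HasRun.vOption {C : Fin (2 ^ k) → Bool} (hr : HasRun A b r) (h : IsVOption k A C) :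
    HasRun C b ((r - 1) / 2) := by
  obtain ⟨p, hp⟩ := hr
  -- The first pair lying wholly in the run; at most one site is lost at each end.
  refine ⟨(p + 1) / 2, fun t ht => h.colourAt ?_ ?_⟩
  · have := hp (2 * ((p + 1) / 2 + t) - p) (by omega)
    rwa [show p + (2 * ((p + 1) / 2 + t) - p) = 2 * ((p + 1) / 2 + t) by omega] at this
  · have := hp (2 * ((p + 1) / 2 + t) + 1 - p) (by omega)
    rwa [show p + (2 * ((p + 1) / 2 + t) + 1 - p) = 2 * ((p + 1) / 2 + t) + 1 by omega] at this

/-- Site `j` above surely has colour `b` if the four sites from `2j - 1` to `2j + 2` lie in the run: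
`V` joins the middle two, and `W` joins each of them to its outer neighbour. -/
theorem HasRun.wOption_vOption {C : Fin (2 ^ (k + 1)) → Bool} {E : Fin (2 ^ k) → Bool}
    (hr : HasRun A b r) (h : IsWOption k A C) (h' : IsVOption k C E) :
    HasRun E b ((r - 3) / 2) := by
  obtain ⟨p, hp⟩ := hr
  have hA : ∀ n, p ≤ n → n < p + r → RandomMERA.colourAt A n = b := fun n h₁ h₂ => by
    have := hp (n - p) (by omega)
    rwa [Nat.add_sub_cancel' h₁] at this
  refine ⟨p / 2 + 1, fun t ht => h'.colourAt ?_ ?_⟩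
  · have := (h.colourAt (n := p / 2 + t) (hA _ (by omega) (by omega))
      (hA _ (by omega) (by omega))).2
    rwa [show 2 * (p / 2 + 1 + t) = 2 * (p / 2 + t) + 2 by omega]
  · have := (h.colourAt (n := p / 2 + t + 1) (hA _ (by omega) (by omega))
      (hA _ (by omega) (by omega))).1
    rwa [show 2 * (p / 2 + 1 + t) + 1 = 2 * (p / 2 + t + 1) + 1 by omega]

/-- A set of sites that is neither empty nor everything cuts some gate of `W` or of `V`. -/
theorem exists_cut (ht : HasRun A true 1) (hf : HasRun A false 1) :
    (∃ j, A (oddSite k j) ≠ A (nextEvenSite k j)) ∨ ∃ j, A (evenSite k j) ≠ A (oddSite k j) := by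
  by_contra! h
  -- Neighbours on the ring alternately share a gate of `V` and a gate of `W`.
  have step : ∀ n, colourAt A (n + 1) = colourAt A n := by
    intro n
    rcases Nat.even_or_odd' n with ⟨m, rfl | rfl⟩
    · rw [colourAt_even, colourAt_odd]
      exact (h.2 _).symm
    · rw [colourAt_odd, show 2 * m + 1 + 1 = 2 * m + 2 from rfl, colourAt_nextEven]
      exact (h.1 _).symm
  have const : ∀ n, colourAt A n = colourAt A 0 := fun n => by
    induction n with
    | zero => rfl
    | succ n ih => rw [step, ih]
  obtain ⟨p, hp⟩ := ht
  obtain ⟨q, hq⟩ := hf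
  have h1 := hp 0 one_pos
  have h2 := hq 0 one_pos
  rw [const] at h1 h2
  simp [h1] at h2

theorem IsWOption.eq_of_not_cut {C : Fin (2 ^ (k + 1)) → Bool} (h : IsWOption k A C)
    (hA : ∀ j, A (oddSite k j) = A (nextEvenSite k j)) : C = A := by
  funext s
  obtain ⟨j | j, rfl⟩ := (odd_nextEven_bijective k).2 s
  · rcases (h j).1 with h | h
    · exact h
    · exact h.trans (hA j).symm
  · change C (nextEvenSite k j) = A (nextEvenSite k j)
    rw [(h j).2]
    rcases (h j).1 with h | h
    · exact h.trans (hA j)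
    · exact h

/-- If one site has a colour that no other site has, then it cuts a gate of `W`. -/
theorem exists_cutW_of_isolated (s₀ : Fin (2 ^ (k + 1))) (h : ∀ s, s ≠ s₀ → A s ≠ A s₀) :
    ∃ j, A (oddSite k j) ≠ A (nextEvenSite k j) := by
  obtain ⟨j | j, hj⟩ := (odd_nextEven_bijective k).2 s₀
  · refine ⟨j, fun e => h (nextEvenSite k j) (fun e' => ?_) ?_⟩
    · simpa using (odd_nextEven_bijective k).1 (a₁ := Sum.inr j) (a₂ := Sum.inl j)
        (e'.trans hj.symm)
    · rw [← hj]; exact e.symm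
  · refine ⟨j, fun e => h (oddSite k j) (fun e' => ?_) ?_⟩
    · simpa using (odd_nextEven_bijective k).1 (a₁ := Sum.inl j) (a₂ := Sum.inr j)
        (e'.trans hj.symm)
    · rw [← hj]; exact e

theorem exists_cutV_of_isolated (s₀ : Fin (2 ^ (k + 1))) (h : ∀ s, s ≠ s₀ → A s ≠ A s₀) :
    ∃ j, A (evenSite k j) ≠ A (oddSite k j) := by
  obtain ⟨j | j, hj⟩ := (even_odd_bijective k).2 s₀
  · refine ⟨j, fun e => h (oddSite k j) (fun e' => ?_) ?_⟩
    · simpa using (even_odd_bijective k).1 (a₁ := Sum.inr j) (a₂ := Sum.inl j)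
        (e'.trans hj.symm)
    · rw [← hj]; exact e.symm
  · refine ⟨j, fun e => h (evenSite k j) (fun e' => ?_) ?_⟩
    · simpa using (even_odd_bijective k).1 (a₁ := Sum.inl j) (a₂ := Sum.inr j)
        (e'.trans hj.symm)
    · rw [← hj]; exact e

end Runs

/-! ### Purity bounds for colourings with runs of both colours -/

section Bounds

variable {L : ℕ} {B : Dims L}

/-- A cut gate of `W` gives `2 / D`, which is at most `2 / D'`. If `W` is not cut, it hands the
colouring on unchanged, and then `V` is cut. -/
theorem sigmaPurity_le_of_hasRun_one (hB : ∀ k, 0 < B.D k) (hB' : ∀ k, 0 < B.D' k) (k : ℕ)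
    (hk : k + 1 ≤ L) (A : Fin (2 ^ (k + 1)) → Bool) (ht : HasRun A true 1)
    (hf : HasRun A false 1) : sigmaPurity B (k + 1) hk A ≤ 2 / B.D' (k + 1) := by
  by_cases h : ∃ j, A (oddSite k j) ≠ A (nextEvenSite k j)
  · obtain ⟨j, hj⟩ := h
    refine (sigmaPurity_succ_le_of_cut hB hB' k hk A hj).trans ?_
    have h1 : (0 : ℝ) < B.D' (k + 1) := by exact_mod_cast hB' _
    have h2 : (B.D' (k + 1) : ℝ) ≤ B.D (k + 1) := by exact_mod_cast B.hW k hk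
    gcongr
  · have hV := (exists_cut ht hf).resolve_left h
    push Not at h
    obtain ⟨j, hj⟩ := hV
    refine sigmaPurity_succ_le B k hk (hB _) A (by positivity) fun C hC => ?_
    rw [hC.eq_of_not_cut h]
    exact tauPurity_succ_le_of_cut hB hB' k hk A hj

/-- Up to rounding, `r ↦ (r - 3) / 2` halves `r + 3`, so the condition `4 * 2 ^ t ≤ r + 3` passes
from level to level; at `t = 0` it says that the runs are nonempty. -/
theorem sigmaPurity_le_of_hasRun (hB : ∀ k, 0 < B.D k) (hB' : ∀ k, 0 < B.D' k) (t : ℕ) :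
    ∀ (k : ℕ) (hk : k + 1 ≤ L) (A : Fin (2 ^ (k + 1)) → Bool) (r : ℕ), t ≤ k →
      4 * 2 ^ t ≤ r + 3 → HasRun A true r → HasRun A false r →
      sigmaPurity B (k + 1) hk A ≤ 2 / B.D' (k + 1 - t) := by
  induction t with
  | zero =>
    intro k hk A r _ hr ht hf
    exact sigmaPurity_le_of_hasRun_one hB hB' k hk A (ht.mono (by omega)) (hf.mono (by omega))
  | succ t ih =>
    intro k hk A r htk hr ht hf
    obtain ⟨k, rfl⟩ : ∃ k', k = k' + 1 := ⟨k - 1, by omega⟩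
    refine sigmaPurity_succ_le B _ hk (hB _) A (by positivity) fun C hC =>
      tauPurity_succ_le B _ hk (hB' _) C (by positivity) fun E hE => ?_
    rw [show k + 1 + 1 - (t + 1) = k + 1 - t by omega]
    have h1 : 1 ≤ 2 ^ t := Nat.one_le_two_pow
    rw [pow_succ] at hr
    exact ih k (by omega) E ((r - 3) / 2) (by omega) (by omega) (ht.wOption_vOption hC hE)
      (hf.wOption_vOption hC hE)

theorem tauPurity_le_of_hasRun (hB : ∀ k, 0 < B.D k) (hB' : ∀ k, 0 < B.D' k) (t : ℕ) (k : ℕ)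
    (hk : k + 1 ≤ L) (A : Fin (2 ^ (k + 1)) → Bool) (r : ℕ) (htk : t < k)
    (hr : 4 * 2 ^ (t + 1) ≤ r + 3) (ht : HasRun A true r) (hf : HasRun A false r) :
    tauPurity B (k + 1) hk A ≤ 2 / B.D' (k - t) := by
  obtain ⟨k, rfl⟩ : ∃ k', k = k' + 1 := ⟨k - 1, by omega⟩
  refine tauPurity_succ_le B _ hk (hB' _) A (by positivity) fun E hE => ?_
  have h1 : 1 ≤ 2 ^ t := Nat.one_le_two_pow
  rw [pow_succ] at hr
  exact sigmaPurity_le_of_hasRun hB hB' t k (by omega) E ((r - 1) / 2) (by omega) (by omega)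
    (ht.vOption hE) (hf.vOption hE)

/-- A set that cuts no gate of `V` is handed on unchanged to the next level. -/
theorem tauPurity_le_of_not_cut (hB : ∀ k, 0 < B.D k) (hB' : ∀ k, 0 < B.D' k) (k : ℕ)
    (hk : k + 1 + 1 ≤ L) (A : Fin (2 ^ (k + 1 + 1)) → Bool) (ht : HasRun A true 1)
    (hf : HasRun A false 1) (h : ∀ j, A (evenSite (k + 1) j) = A (oddSite (k + 1) j)) :
    tauPurity B (k + 1 + 1) hk A ≤ 2 / B.D' (k + 1) := by
  refine tauPurity_succ_le B _ hk (hB' _) A (by positivity) fun E hE => ?_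
  have key : ∀ b, HasRun A b 1 → HasRun E b 1 := by
    rintro b ⟨p, hp⟩
    have hp := hp 0 one_pos
    rw [add_zero] at hp
    refine ⟨p / 2, fun t ht => ?_⟩
    rw [Nat.lt_one_iff.1 ht, add_zero]
    -- Both sites of the pair containing `p` have the colour of `p`, so the site above inherits it.
    have e : colourAt A (2 * (p / 2)) = colourAt A (2 * (p / 2) + 1) := by
      rw [colourAt_even, colourAt_odd]; exact h _
    have : p = 2 * (p / 2) ∨ p = 2 * (p / 2) + 1 := by omega
    rcases this with h' | h'
    · rw [h'] at hp
      exact hE.colourAt hp (e ▸ hp)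
    · rw [h'] at hp
      exact hE.colourAt (e ▸ hp) hp
  exact sigmaPurity_le_of_hasRun_one hB hB' k (by omega) E (key _ ht) (key _ hf)

end Bounds

/-! ### Intervals -/

section Intervals

theorem mem_interval {n : ℕ} (i : Fin n) (l : ℕ) (s : Fin n) :
    s ∈ interval i l ↔ ∃ t < l, (i.val + t) % n = s.val := by
  simp [interval, Fin.ext_iff]

theorem notMem_interval {n : ℕ} (i : Fin n) {l t : ℕ} (hl : l ≤ t) (ht : t < n) (s : Fin n)
    (hs : s.val = (i.val + t) % n) : s ∉ interval i l := by
  rw [mem_interval]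
  rintro ⟨t', ht', h⟩
  rw [hs] at h
  have := Nat.ModEq.add_left_cancel' i.val h
  rw [Nat.ModEq, Nat.mod_eq_of_lt (by omega), Nat.mod_eq_of_lt ht] at this
  omega

theorem exists_eq_add_mod {n : ℕ} (i s : Fin n) : ∃ t < n, s.val = (i.val + t) % n := by
  have hi := i.isLt
  have hs := s.isLt
  by_cases h : i.val ≤ s.val
  · exact ⟨s.val - i.val, by omega, by rw [Nat.mod_eq_of_lt] <;> omega⟩
  · refine ⟨s.val + n - i.val, by omega, ?_⟩
    rw [show i.val + (s.val + n - i.val) = s.val + n by omega, Nat.add_mod_right,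
      Nat.mod_eq_of_lt hs]

variable {k : ℕ} (i : Fin (2 ^ k)) (l : ℕ)

theorem hasRun_interval_true : HasRun (fun s => decide (s ∈ interval i l)) true l :=
  ⟨i.val, fun t ht => by simpa [colourAt] using (mem_interval i l _).2 ⟨t, ht, rfl⟩⟩

theorem hasRun_interval_false :
    HasRun (fun s => decide (s ∈ interval i l)) false (2 ^ k - l) :=
  ⟨i.val + l, fun t ht => by
    simpa [colourAt] using notMem_interval i (l := l) (t := l + t) (by omega) (by omega) _
      (by rw [add_assoc])⟩

/-- For `m = 1` the isolated site cuts a gate of whichever row comes last, so no level is lost. -/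
theorem exists_isolated (hl : 1 ≤ l) (hl' : l < 2 ^ k) (h : min l (2 ^ k - l) = 1) :
    ∃ s₀, ∀ s, s ≠ s₀ → decide (s ∈ interval i l) ≠ decide (s₀ ∈ interval i l) := by
  by_cases h1 : l = 1
  · subst h1
    have hm : ∀ s, s ∈ interval i 1 ↔ s = i := by
      intro s
      rw [mem_interval]
      simp [Nat.mod_eq_of_lt i.isLt, Fin.ext_iff, eq_comm]
    exact ⟨i, fun s hs => by simp [hm, hs]⟩
  · have h2 : l = 2 ^ k - 1 := by omega
    -- The complement consists of the single site after the end of the interval.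
    refine ⟨⟨(i.val + l) % 2 ^ k, Nat.mod_lt _ (by positivity)⟩, fun s hs => ?_⟩
    have hn := notMem_interval i (l := l) le_rfl hl'
      ⟨(i.val + l) % 2 ^ k, Nat.mod_lt _ (by positivity)⟩ rfl
    have hm : s ∈ interval i l := by
      obtain ⟨t, ht, hst⟩ := exists_eq_add_mod i s
      refine (mem_interval i l s).2 ⟨t, ?_, hst.symm⟩
      by_contra hlt
      have : t = l := by omega
      subst this
      exact hs (Fin.ext hst)
    simp [hn, hm]

end Intervals

/-! ### Entropy and purity -/

section Entropy

open scoped ComplexOrder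

variable {ι : Type*} [Fintype ι] [DecidableEq ι] {ρ : Matrix ι ι ℂ}

theorem vonNeumannEntropy_eq (h : ρ.IsHermitian) :
    vonNeumannEntropy ρ = ∑ a, Real.negMulLog (h.eigenvalues a) := by
  rw [vonNeumannEntropy, dif_pos h]

theorem trace_pow_eq_sum_eigenvalues (h : ρ.IsHermitian) (n : ℕ) :
    (ρ ^ n).trace = ∑ a, ((h.eigenvalues a ^ n : ℝ) : ℂ) := by
  conv_lhs => rw [h.spectral_theorem, ← map_pow, Matrix.diagonal_pow]
  rw [Unitary.conjStarAlgAut_apply, Matrix.trace_mul_comm, ← mul_assoc]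
  simp [Matrix.trace_diagonal]

theorem trace_aeval_eq_sum_eigenvalues (h : ρ.IsHermitian) (p : Polynomial ℝ) :
    (Polynomial.aeval ρ p).trace = ∑ a, ((p.eval (h.eigenvalues a) : ℝ) : ℂ) := by
  rw [Polynomial.aeval_eq_sum_range, Matrix.trace_sum]
  simp only [Matrix.trace_smul, trace_pow_eq_sum_eigenvalues h, Polynomial.eval_eq_sum_range]
  simp only [Complex.ofReal_sum, Finset.smul_sum]
  rw [Finset.sum_comm]
  simp

theorem sum_eigenvalues_eq_one (h : ρ.IsHermitian) (htr : ρ.trace = 1) :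
    ∑ a, h.eigenvalues a = 1 := by
  have := trace_pow_eq_sum_eigenvalues h 1
  simp only [pow_one, htr] at this
  exact_mod_cast this.symm

theorem eigenvalues_mem_Icc (h : ρ.PosSemidef) (htr : ρ.trace = 1) (a : ι) :
    h.1.eigenvalues a ∈ Set.Icc (0 : ℝ) 1 :=
  ⟨h.eigenvalues_nonneg a, (sum_eigenvalues_eq_one h.1 htr).symm ▸
    Finset.single_le_sum (f := h.1.eigenvalues) (fun i _ => h.eigenvalues_nonneg i)
      (Finset.mem_univ a)⟩

/-- The tangent line bound of the entropy by the purity. -/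
theorem le_vonNeumannEntropy (h : ρ.PosSemidef) (htr : ρ.trace = 1) {c : ℝ} (hc : 0 < c) :
    1 - Real.log c - (ρ ^ 2).trace.re / c ≤ vonNeumannEntropy ρ := by
  rw [vonNeumannEntropy_eq h.1, trace_pow_eq_sum_eigenvalues h.1, ← Complex.ofReal_sum,
    Complex.ofReal_re]
  -- This is `log x ≤ x - 1` at `x = λ / c`, multiplied by the eigenvalue `λ`; `λ = 0` is separate.
  have h1 : ∀ a, (1 - Real.log c) * h.1.eigenvalues a - h.1.eigenvalues a ^ 2 / c ≤
      Real.negMulLog (h.1.eigenvalues a) := by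
    intro a
    rcases (h.eigenvalues_nonneg a).eq_or_lt with h0 | h0
    · simp [← h0]
    · have := Real.log_le_sub_one_of_pos (div_pos h0 hc)
      rw [Real.log_div h0.ne' hc.ne'] at this
      rw [Real.negMulLog]
      have e : (1 - Real.log c) * h.1.eigenvalues a - h.1.eigenvalues a ^ 2 / c =
        h.1.eigenvalues a * (1 - Real.log c - h.1.eigenvalues a / c) := by ring
      rw [e]
      nlinarith
  calc _ = ∑ a, ((1 - Real.log c) * h.1.eigenvalues a - h.1.eigenvalues a ^ 2 / c) := by
        rw [Finset.sum_sub_distrib, ← Finset.mul_sum, sum_eigenvalues_eq_one h.1 htr,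
          Finset.sum_div, mul_one]
    _ ≤ _ := Finset.sum_le_sum fun a _ => h1 a

theorem abs_vonNeumannEntropy_le (h : ρ.PosSemidef) (htr : ρ.trace = 1) :
    ‖vonNeumannEntropy ρ‖ ≤ Fintype.card ι := by
  rw [vonNeumannEntropy_eq h.1]
  refine (norm_sum_le _ _).trans ?_
  refine (Finset.sum_le_card_nsmul _ _ 1 fun a _ => ?_).trans (by simp)
  obtain ⟨h0, h1⟩ := eigenvalues_mem_Icc h htr a
  rw [Real.norm_of_nonneg (Real.negMulLog_nonneg h0 h1)]
  exact (Real.negMulLog_le_one_sub_self h0).trans (by linarith)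

/-- This serves measurability. Traces of polynomials in `ρ` are continuous in `ρ`, and Weierstrass
approximation, with polynomials independent of `ρ`, makes the entropy their pointwise limit, so
eigenvalues need not be chosen measurably. -/
theorem exists_polynomial_tendsto_vonNeumannEntropy (ι : Type*) [Fintype ι] [DecidableEq ι] :
    ∃ p : ℕ → Polynomial ℝ, ∀ ρ : Matrix ι ι ℂ, ρ.PosSemidef → ρ.trace = 1 →
      Filter.Tendsto (fun n => (Polynomial.aeval ρ (p n)).trace.re) Filter.atTop
        (nhds (vonNeumannEntropy ρ)) := by
  have hp : ∀ n : ℕ, ∃ p : Polynomial ℝ, ∀ x ∈ Set.Icc (0 : ℝ) 1,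
      |p.eval x - Real.negMulLog x| < 1 / ((n : ℝ) + 1) := fun n =>
    exists_polynomial_near_of_continuousOn 0 1 _ Real.continuous_negMulLog.continuousOn _
      Nat.one_div_pos_of_nat
  choose p hp using hp
  refine ⟨p, fun ρ h htr => ?_⟩
  simp only [trace_aeval_eq_sum_eigenvalues h.1, ← Complex.ofReal_sum, Complex.ofReal_re,
    vonNeumannEntropy_eq h.1]
  refine tendsto_finsetSum _ fun a _ => ?_
  rw [tendsto_iff_norm_sub_tendsto_zero]
  exact squeeze_zero (fun _ => norm_nonneg _)
    (fun n => (hp n _ (eigenvalues_mem_Icc h htr a)).le) tendsto_one_div_add_atTop_nhds_zero_nat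

theorem integrable_vonNeumannEntropy {X : Type*} [TopologicalSpace X] [MeasurableSpace X]
    [OpensMeasurableSpace X] (μ : Measure X) [IsFiniteMeasure μ] {ρ : X → Matrix ι ι ℂ}
    (hc : Continuous ρ) (h : ∀ x, (ρ x).PosSemidef) (htr : ∀ x, (ρ x).trace = 1) :
    Integrable (fun x => vonNeumannEntropy (ρ x)) μ := by
  obtain ⟨p, hp⟩ := exists_polynomial_tendsto_vonNeumannEntropy ι
  refine Integrable.of_bound (Measurable.aestronglyMeasurable ?_) (Fintype.card ι)
    (Filter.Eventually.of_forall fun x => abs_vonNeumannEntropy_le (h x) (htr x))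
  refine measurable_of_tendsto_metrizable (f := fun n x => (Polynomial.aeval (ρ x) (p n)).trace.re)
    (fun n => Continuous.measurable ?_)
    (tendsto_pi_nhds.2 fun x => hp _ (h x) (htr x))
  refine Complex.continuous_re.comp (Continuous.matrix_trace ?_)
  simp only [Polynomial.aeval_eq_sum_range]
  exact continuous_finsetSum _ fun i _ => Continuous.const_smul (hc.pow i) ((p n).coeff i)

end Entropy

/-! ### Reduced density matrices of pure states -/

section Reduced

open scoped ComplexOrder

variable {n d : ℕ}

/-- The coefficients of a state as a matrix from the complement of `A` to `A`. -/
def coeffMatrix (φ : (Fin n → Fin d) → ℂ) (A : Finset (Fin n)) :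
    Matrix ({s // s ∈ A} → Fin d) ({s // s ∉ A} → Fin d) ℂ :=
  Matrix.of fun a c => φ ((Equiv.piEquivPiSubtypeProd (fun s => s ∈ A) fun _ => Fin d).symm (a, c))

theorem reduced_projector (φ : (Fin n → Fin d) → ℂ) (A : Finset (Fin n)) :
    reduced (projector φ) A = coeffMatrix φ A * (coeffMatrix φ A).conjTranspose := by
  ext a b
  simp [reduced, projector, coeffMatrix, Matrix.mul_apply, Matrix.vecMulVec_apply]

theorem posSemidef_reduced_projector (φ : (Fin n → Fin d) → ℂ) (A : Finset (Fin n)) :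
    (reduced (projector φ) A).PosSemidef := by
  rw [reduced_projector]
  exact Matrix.posSemidef_self_mul_conjTranspose _

theorem trace_reduced_projector (φ : (Fin n → Fin d) → ℂ) (A : Finset (Fin n)) :
    (reduced (projector φ) A).trace = ∑ x, φ x * star (φ x) := by
  rw [← Equiv.sum_comp (Equiv.piEquivPiSubtypeProd (fun s => s ∈ A) fun _ => Fin d).symm,
    Fintype.sum_prod_type]
  rfl

theorem mix_piEquivPiSubtypeProd (A : Finset (Fin n)) (p q : ({s // s ∈ A} → Fin d) ×
    ({s // s ∉ A} → Fin d)) :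
    mix (fun s => decide (s ∈ A))
      ((Equiv.piEquivPiSubtypeProd (fun s => s ∈ A) fun _ => Fin d).symm p)
      ((Equiv.piEquivPiSubtypeProd (fun s => s ∈ A) fun _ => Fin d).symm q) =
    (Equiv.piEquivPiSubtypeProd (fun s => s ∈ A) fun _ => Fin d).symm (p.1, q.2) := by
  funext s
  by_cases h : s ∈ A <;> simp [mix, h, Equiv.piEquivPiSubtypeProd]

theorem trace_reduced_projector_sq (φ : (Fin n → Fin d) → ℂ) (A : Finset (Fin n)) :
    ((reduced (projector φ) A) ^ 2).trace = purity (fun s => decide (s ∈ A)) φ := by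
  simp only [purity]
  rw [← Equiv.sum_comp (Equiv.piEquivPiSubtypeProd (fun s => s ∈ A) fun _ => Fin d).symm]
  simp only [← Equiv.sum_comp (Equiv.piEquivPiSubtypeProd (fun s => s ∈ A) fun _ => Fin d).symm
    (fun y => _ * φ y * _ * _), mix_piEquivPiSubtypeProd]
  rw [sq, reduced_projector, Matrix.trace]
  simp only [Matrix.diag_apply, Matrix.mul_apply, Matrix.conjTranspose_apply, coeffMatrix,
    Matrix.of_apply, Fintype.sum_prod_type, Finset.sum_mul_sum]
  refine Finset.sum_congr rfl fun a _ => ?_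
  rw [Finset.sum_comm]
  refine Finset.sum_congr rfl fun c _ => Finset.sum_congr rfl fun b _ =>
    Finset.sum_congr rfl fun c' _ => ?_
  ring

theorem continuous_reduced_projector {X : Type*} [TopologicalSpace X]
    {φ : X → (Fin n → Fin d) → ℂ} (h : ∀ y, Continuous fun x => φ x y) (A : Finset (Fin n)) :
    Continuous fun x => reduced (projector (φ x)) A :=
  continuous_matrix fun _ _ => continuous_finsetSum _ fun _ _ => (h _).mul (h _).star

/-- A bound on the expected purity bounds the expected entropy. -/
theorem integral_entropy_ge {X : Type*} [TopologicalSpace X] [CompactSpace X] [MeasurableSpace X]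
    [OpensMeasurableSpace X] (μ : Measure X) [IsProbabilityMeasure μ]
    {φ : X → (Fin n → Fin d) → ℂ} (h : ∀ y, Continuous fun x => φ x y)
    (hn : ∀ x, ∑ y, φ x y * star (φ x y) = 1) (A : Finset (Fin n)) :
    Integrable (fun x => vonNeumannEntropy (reduced (projector (φ x)) A)) μ ∧
      ∀ c : ℝ, 0 < c → (∫ x, purity (fun s => decide (s ∈ A)) (φ x) ∂μ).re ≤ c →
        -Real.log c ≤ ∫ x, vonNeumannEntropy (reduced (projector (φ x)) A) ∂μ := by
  have hi := integrable_vonNeumannEntropy μ (continuous_reduced_projector h A)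
    (fun x => posSemidef_reduced_projector _ _)
    (fun x => (trace_reduced_projector _ _).trans (hn x))
  refine ⟨hi, fun c hc hle => ?_⟩
  have hp : Integrable (fun x => purity (fun s => decide (s ∈ A)) (φ x)) μ :=
    integrable_of_continuous μ (continuous_purity _ h)
  have hpr : Integrable (fun x => (purity (fun s => decide (s ∈ A)) (φ x)).re) μ := hp.re
  have hre : ∫ x, (purity (fun s => decide (s ∈ A)) (φ x)).re ∂μ ≤ c := by
    have := integral_re hp
    simp only [RCLike.re_eq_complex_re] at this
    rw [this]
    exact hle
  -- The tangent bound is affine in the purity, so it is averaged directly with `c` fixed.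
  calc -Real.log c ≤ 1 - Real.log c -
        (∫ x, (purity (fun s => decide (s ∈ A)) (φ x)).re ∂μ) / c := by
        have := (div_le_one hc).2 hre
        linarith
    _ = ∫ x, (1 - Real.log c - (purity (fun s => decide (s ∈ A)) (φ x)).re / c) ∂μ := by
        rw [integral_sub (integrable_const _) (hpr.div_const c), integral_div, integral_const]
        simp
    _ ≤ _ := by
        refine integral_mono ((integrable_const _).sub (hpr.div_const c)) hi fun x => ?_
        have := le_vonNeumannEntropy (posSemidef_reduced_projector (φ x) A)
          ((trace_reduced_projector _ _).trans (hn x)) hc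
        rwa [trace_reduced_projector_sq] at this

end Reduced

/-! ### The chosen dimensions -/

section Dimensions

variable {DL : ℕ} {ε : ℝ}

theorem log_bondDim_succ_le (hε : 0 < ε) (m : ℕ) :
    Real.log (bondDim DL ε (m + 1)) ≤ 2 * Real.log (primeDim ε (bondDim DL ε m) m) := by
  have hp : (0 : ℝ) < primeDim ε (bondDim DL ε m) m := by exact_mod_cast primeDim_pos _ _ _
  have hb : (0 : ℝ) < bondDim DL ε (m + 1) := by exact_mod_cast Nat.ceil_pos.2 (Real.exp_pos _)
  calc Real.log (bondDim DL ε (m + 1)) ≤ Real.log ((primeDim ε (bondDim DL ε m) m : ℝ) *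
        primeDim ε (bondDim DL ε m) m) :=
        Real.log_le_log hb (by exact_mod_cast bondDim_succ_le hε m)
    _ = _ := by rw [Real.log_mul hp.ne' hp.ne']; ring

theorem log_primeDim_le (hε : 0 < ε) {D : ℕ} (hD : 0 < D) (m : ℕ) :
    Real.log (primeDim ε D m) ≤ Real.log D :=
  Real.log_le_log (by exact_mod_cast primeDim_pos _ _ _) (by exact_mod_cast primeDim_le hε hD m)

theorem log_sub_le_log_primeDim (D m : ℕ) :
    Real.log D - ε * 2 ^ m ≤ Real.log (primeDim ε D m) := by
  rw [Real.le_log_iff_exp_le (by exact_mod_cast primeDim_pos _ _ _)]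
  exact Nat.le_ceil _

/-- Each level up at most squares the dimension, so two levels cost a factor four in the logarithm.
For `a = 1` truncated subtraction gives level `0`, and a factor two suffices. -/
theorem log_bondDim_le (hD : 1 < DL) (hε : 0 < ε) {a : ℕ} (ha : 1 ≤ a) :
    Real.log (bondDim DL ε a) ≤ 4 * Real.log (primeDim ε (bondDim DL ε (a - 2)) (a - 2)) := by
  have hn : ∀ m, 0 ≤ Real.log (primeDim ε (bondDim DL ε m) m) := fun m => Real.log_natCast_nonneg _
  obtain rfl | ⟨b, rfl⟩ : a = 1 ∨ ∃ b, a = b + 1 + 1 := by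
    rcases Nat.lt_or_ge a 2 with h | h
    · exact Or.inl (by omega)
    · exact Or.inr ⟨a - 2, by omega⟩
  · have := log_bondDim_succ_le (DL := DL) hε 0
    have := hn 0
    norm_num at *
    linarith
  · have h1 := log_bondDim_succ_le (DL := DL) hε (b + 1)
    have h2 := log_primeDim_le hε (bondDim_pos (ε := ε) hD (b + 1)) (b + 1)
    have h3 := log_bondDim_succ_le (DL := DL) hε b
    rw [show b + 1 + 1 - 2 = b by omega]
    linarith

end Dimensions

/-! ### Purity bounds for intervals -/

section Main

variable {DL L : ℕ} {ε : ℝ} (hD : 1 < DL) (hε : 0 < ε) (h0 : bondDim DL ε L = 1)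

theorem chosenDims_D_pos (k : ℕ) : 0 < (chosenDims DL L ε hD hε h0).D k := bondDim_pos hD _

theorem chosenDims_D'_pos (k : ℕ) : 0 < (chosenDims DL L ε hD hε h0).D' k := primeDim_pos _ _ _

theorem neg_log_two_div {D : ℕ} (hD : 0 < D) : -Real.log (2 / D) = Real.log D - Real.log 2 := by
  rw [Real.log_div two_ne_zero (by exact_mod_cast hD.ne')]
  ring

variable {i : Fin (2 ^ L)} {l m : ℕ}

theorem log_min_lt (hl : 1 ≤ l) (hl' : l < 2 ^ L) (hm : m = min l (2 ^ L - l)) :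
    Nat.log 2 m < L := by
  have hm1 : 1 ≤ m := by omega
  have h := Nat.pow_log_le_self 2 (Nat.one_le_iff_ne_zero.1 hm1)
  exact (Nat.pow_lt_pow_iff_right (by norm_num : 1 < 2)).1 (by omega)

theorem sigmaPurity_interval_le (hl : 1 ≤ l) (hl' : l < 2 ^ L) (hm : m = min l (2 ^ L - l)) :
    ∃ c : ℝ, 0 < c ∧ sigmaPurity (chosenDims DL L ε hD hε h0) L le_rfl
        (fun s => decide (s ∈ interval i l)) ≤ c ∧
      Real.log (bondDim DL ε (Nat.log 2 m)) / 4 - 1 ≤ -Real.log c := by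
  have hlog2 := Real.log_two_lt_d9
  have haL := log_min_lt hl hl' hm
  have hm1 : 1 ≤ m := by omega
  have hpow := Nat.pow_log_le_self 2 (Nat.one_le_iff_ne_zero.1 hm1)
  have hlt := Nat.lt_pow_succ_log_self (b := 2) (by norm_num) m
  have hB := chosenDims_D_pos hD hε h0
  have hB' := chosenDims_D'_pos hD hε h0
  have ht := (hasRun_interval_true i l).mono (r' := m) (by omega)
  have hf := (hasRun_interval_false i l).mono (r' := m) (by omega)
  obtain ⟨k, rfl⟩ : ∃ k, L = k + 1 := ⟨L - 1, by omega⟩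
  set a := Nat.log 2 m
  -- Here `m = 1`, and the cut gate of `W_L` gives `D_L` itself. A bound by `D'_L` could lose `ε`,
  -- which is not bounded in this case.
  by_cases ha : a = 0
  · rw [ha] at hlt ⊢
    obtain ⟨s₀, hs₀⟩ := exists_isolated i l hl hl' (by omega)
    obtain ⟨j, hj⟩ := exists_cutW_of_isolated s₀ hs₀
    have hDk := hB (k + 1)
    refine ⟨_, ?_, sigmaPurity_succ_le_of_cut hB hB' k le_rfl _ hj, ?_⟩
    · have : (0 : ℝ) < (chosenDims DL (k + 1) ε hD hε h0).D (k + 1) := by exact_mod_cast hDk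
      positivity
    · rw [neg_log_two_div hDk]
      simp only [chosenDims, Nat.sub_self]
      have := Real.log_natCast_nonneg (bondDim DL ε 0)
      linarith
  · have hDk := hB' (k + 1 - (a - 2))
    -- For `a ≥ 2` this is weaker than `2 ^ a ≤ m`; for `a = 1` the subtraction truncates and `m ≥
    -- 2` suffices.
    have hr : 4 * 2 ^ (a - 2) ≤ m + 3 := by
      obtain h | h | ⟨b, hb⟩ : a = 1 ∨ a = 2 ∨ ∃ b, a = b + 2 := by
        rcases Nat.lt_or_ge a 2 with h | h
        · exact Or.inl (by omega)
        · exact Or.inr (Or.inr ⟨a - 2, by omega⟩)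
      · rw [h] at hpow ⊢; norm_num at *; omega
      · rw [h] at hpow ⊢; norm_num at *; omega
      · rw [hb, pow_add] at hpow
        rw [hb, Nat.add_sub_cancel]
        omega
    refine ⟨_, ?_, sigmaPurity_le_of_hasRun hB hB' (a - 2) k le_rfl _ m (by omega) hr ht hf, ?_⟩
    · have : (0 : ℝ) < (chosenDims DL (k + 1) ε hD hε h0).D' (k + 1 - (a - 2)) := by
        exact_mod_cast hDk
      positivity
    · rw [neg_log_two_div hDk]
      have := log_bondDim_le (ε := ε) hD hε (a := a) (by omega)
      simp only [chosenDims, show k + 1 - (k + 1 - (a - 2)) = a - 2 by omega]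
      linarith

theorem tauPurity_interval_le (hε1 : ε ≤ 1) (hl : 1 ≤ l) (hl' : l < 2 ^ L)
    (hm : m = min l (2 ^ L - l)) :
    ∃ c : ℝ, 0 < c ∧ tauPurity (chosenDims DL L ε hD hε h0) L le_rfl
        (fun s => decide (s ∈ interval i l)) ≤ c ∧
      Real.log (bondDim DL ε (Nat.log 2 m)) / 4 - 3 ≤ -Real.log c := by
  have hlog2 := Real.log_two_lt_d9
  have haL := log_min_lt hl hl' hm
  have hm1 : 1 ≤ m := by omega
  have hpow := Nat.pow_log_le_self 2 (Nat.one_le_iff_ne_zero.1 hm1)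
  have hlt := Nat.lt_pow_succ_log_self (b := 2) (by norm_num) m
  have hB := chosenDims_D_pos hD hε h0
  have hB' := chosenDims_D'_pos hD hε h0
  have ht := (hasRun_interval_true i l).mono (r' := m) (by omega)
  have hf := (hasRun_interval_false i l).mono (r' := m) (by omega)
  have hn : ∀ b, 0 ≤ Real.log (primeDim ε (bondDim DL ε b) b) := fun b =>
    Real.log_natCast_nonneg _
  have hbn : ∀ b, 0 ≤ Real.log (bondDim DL ε b) := fun b => Real.log_natCast_nonneg _
  have hpos : ∀ k, (0 : ℝ) < 2 / (chosenDims DL L ε hD hε h0).D' k := fun k => by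
    have : (0 : ℝ) < (chosenDims DL L ε hD hε h0).D' k := by exact_mod_cast hB' k
    positivity
  obtain ⟨k, rfl⟩ : ∃ k, L = k + 1 := ⟨L - 1, by omega⟩
  set a := Nat.log 2 m
  -- From `a = 3` on, the bottom row of `V` followed by `a - 3` full levels reaches the same
  -- dimension `D'_{L-a+2}` as for `σ`.
  by_cases ha : 3 ≤ a
  · obtain ⟨t, hat⟩ : ∃ t, a = t + 1 + 2 := ⟨a - 3, by omega⟩
    have hr : 4 * 2 ^ (t + 1) ≤ m + 3 := by
      rw [hat, pow_add] at hpow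
      omega
    refine ⟨_, hpos _, tauPurity_le_of_hasRun hB hB' t k le_rfl _ m (by omega) hr ht hf, ?_⟩
    rw [neg_log_two_div (hB' _)]
    have := log_bondDim_le (ε := ε) hD hε (a := a) (by omega)
    rw [show a - 2 = t + 1 by omega] at this
    simp only [chosenDims, show k + 1 - (k - t) = t + 1 by omega]
    linarith
  by_cases hcut : ∃ j, (fun s => decide (s ∈ interval i l)) (evenSite k j) ≠
      (fun s => decide (s ∈ interval i l)) (oddSite k j)
  · obtain ⟨j, hj⟩ := hcut
    refine ⟨_, hpos _, tauPurity_succ_le_of_cut hB hB' k le_rfl _ hj, ?_⟩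
    rw [neg_log_two_div (hB' _)]
    simp only [chosenDims, Nat.sub_self]
    -- For `a = 0`, passing from `D_L` to `D'_L` costs `ε ≤ 1`; for `a = 1, 2`, `log_bondDim_le`
    -- compares with `D'_L` directly.
    by_cases ha0 : a = 0
    · rw [ha0]
      have := log_sub_le_log_primeDim (ε := ε) (bondDim DL ε 0) 0
      have := hbn 0
      norm_num at *
      linarith
    · have := log_bondDim_le (ε := ε) hD hε (a := a) (by omega)
      rw [show a - 2 = 0 by omega] at this
      linarith
  -- An isolated site would cut `V`, so `a ≥ 1`; as `a < L`, a second level exists.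
  · have ha0 : a ≠ 0 := fun h => hcut (by
      rw [h] at hlt
      obtain ⟨s₀, hs₀⟩ := exists_isolated i l hl hl' (by omega)
      exact exists_cutV_of_isolated s₀ hs₀)
    push Not at hcut
    obtain ⟨k, rfl⟩ : ∃ k', k = k' + 1 := ⟨k - 1, by omega⟩
    refine ⟨_, hpos _, tauPurity_le_of_not_cut hB hB' k le_rfl _ (ht.mono hm1) (hf.mono hm1)
      hcut, ?_⟩
    rw [neg_log_two_div (hB' _)]
    simp only [chosenDims, show k + 1 + 1 - (k + 1) = 1 by omega]
    -- For `a = 1`, passing from `D_{L-1}` to `D'_{L-1}` costs `2ε ≤ 2`; for `a = 2` the cost is a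
    -- factor two in the logarithm.
    obtain h | h : a = 1 ∨ a = 2 := by omega
    · rw [h]
      have := log_sub_le_log_primeDim (ε := ε) (bondDim DL ε 1) 1
      have := hbn 1
      norm_num at *
      linarith
    · rw [h]
      have := log_bondDim_succ_le (DL := DL) hε 1
      have := hn 1
      norm_num at *
      linarith

end Main
end

end RandomMERA

theorem lemma2 :
    ∃ c₁ c₂ c₃ : ℝ, 0 < c₁ ∧ 0 < c₂ ∧ 0 < c₃ ∧
      ∀ (DL L : ℕ) (ε : ℝ) (hD : 1 < DL) (hε : 0 < ε)
        (h0 : RandomMERA.bondDim DL ε L = 1)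
        (i : Fin (2 ^ L)) (l m : ℕ), 1 ≤ l → l < 2 ^ L → m = min l (2 ^ L - l) →
        (MeasureTheory.Integrable
            (RandomMERA.sigmaEntropy (RandomMERA.chosenDims DL L ε hD hε h0) i l)
            (RandomMERA.law (RandomMERA.chosenDims DL L ε hD hε h0)) ∧
          c₁ * Real.log ((RandomMERA.chosenDims DL L ε hD hε h0).D (L - Nat.log 2 m))
              - c₂ * Real.log m - c₃ ≤
            ∫ ω, RandomMERA.sigmaEntropy (RandomMERA.chosenDims DL L ε hD hε h0) i l ω
              ∂(RandomMERA.law (RandomMERA.chosenDims DL L ε hD hε h0))) ∧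
        (ε ≤ 1 →
          MeasureTheory.Integrable
            (RandomMERA.tauEntropy (RandomMERA.chosenDims DL L ε hD hε h0) i l)
            (RandomMERA.law (RandomMERA.chosenDims DL L ε hD hε h0)) ∧
          c₁ * Real.log ((RandomMERA.chosenDims DL L ε hD hε h0).D (L - Nat.log 2 m))
              - c₂ * Real.log m - c₃ ≤
            ∫ ω, RandomMERA.tauEntropy (RandomMERA.chosenDims DL L ε hD hε h0) i l ω
              ∂(RandomMERA.law (RandomMERA.chosenDims DL L ε hD hε h0))) := by
  -- The `1/4` comes from `log_bondDim_le`, and `3` exceeds `log 2 + 2ε` for `ε ≤ 1`. No `log m`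
  -- term is needed, so any positive `c₂` works.
  refine ⟨1 / 4, 1, 3, by norm_num, by norm_num, by norm_num, ?_⟩
  intro DL L ε hD hε h0 i l m hl hl' hm
  have haL := RandomMERA.log_min_lt hl hl' hm
  have hdim : (RandomMERA.chosenDims DL L ε hD hε h0).D (L - Nat.log 2 m) =
      RandomMERA.bondDim DL ε (Nat.log 2 m) := by
    simp only [RandomMERA.chosenDims, show L - (L - Nat.log 2 m) = Nat.log 2 m by omega]
  have hlogm := Real.log_natCast_nonneg m
  rw [hdim]
  refine ⟨?_, fun hε1 => ?_⟩
  · obtain ⟨hi, hS⟩ := RandomMERA.integral_entropy_ge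
      (RandomMERA.law (RandomMERA.chosenDims DL L ε hD hε h0))
      (RandomMERA.continuous_psi (RandomMERA.chosenDims DL L ε hD hε h0) L le_rfl)
      (fun ω => RandomMERA.sum_norm_psi _ ω L le_rfl) (RandomMERA.interval i l)
    obtain ⟨c, hc, hle, hlog⟩ := RandomMERA.sigmaPurity_interval_le hD hε h0 (i := i) hl hl' hm
    refine ⟨hi, le_trans ?_ (hS c hc hle)⟩
    linarith
  -- `phi` is meaningful only at levels `k + 1`; `L ≠ 0` because `1 ≤ l < 2 ^ L`.
  · obtain ⟨k, rfl⟩ : ∃ k, L = k + 1 := ⟨L - 1, by omega⟩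
    obtain ⟨hi, hS⟩ := RandomMERA.integral_entropy_ge
      (RandomMERA.law (RandomMERA.chosenDims DL (k + 1) ε hD hε h0))
      (RandomMERA.continuous_phi (RandomMERA.chosenDims DL (k + 1) ε hD hε h0) k le_rfl)
      (fun ω => RandomMERA.sum_norm_phi _ ω k le_rfl) (RandomMERA.interval i l)
    obtain ⟨c, hc, hle, hlog⟩ := RandomMERA.tauPurity_interval_le hD hε h0 (i := i) hε1 hl hl' hm
    refine ⟨hi, le_trans ?_ (hS c hc hle)⟩
    linarith
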